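/- Let $\varphi=(1+\sqrt5)/2$ and let $V$ be a Euclidean space, i.e. a finite-dimensional real inner product space. For $\alpha\in V\setminus\{0\}$ let $r_\alpha(x)=x-\frac{2\langle x,\alpha\rangle}{\langle\alpha,\alpha\rangle}\alpha$ be the reflection in $\alpha^\perp$. Let $T\subset V$ be a finite single-length root-shell system over $\mathbb{Z}[\varphi]$, that is, a finite set such that - (R1) $T=-T$; - (R2) all elements of $T$ have the same positive length; - (R3) $r_\alpha(T)=T$ for every $\alpha\in T$; - (R4) all Cartan coefficients $\frac{2\langle\alpha,\beta\rangle}{\langle\alpha,\alpha\rangle}$, $\alpha,\beta\in T$, lie in $\mathbb{Z}[\varphi]$. Assume that $T$ is indecomposable (it is nonempty and is not the union of two nonempty mutually orthogonal subsets) and non-crystallographic (some Cartan coefficient is not in $\mathbb{Z}$). Then $$\operatorname{rank}(T):=\dim_{\mathbb{R}}\operatorname{span}_{\mathbb{R}}T\in\{2,3,4\},$$ and the reflection group $W=\langle r_\alpha:\alpha\in T\rangle$ is the finite reflection group of type $H_2$, $H_3$ or $H_4$, where the type is $H_n$ with $n=\operatorname{rank}(T)$. Explicitly, let $(m_{ij})$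 be the Coxeter matrix of type $H_n$: $m_{ii}=1$, $m_{n-1,n}=m_{n,n-1}=5$, $m_{ij}=3$ for the other pairs with $|i-j|=1$, and $m_{ij}=2$ for $|i-j|\ge2$. Then $T$ contains a basis $a_1,\dots,a_n$ of $\operatorname{span}_{\mathbb{R}}T$ with $\langle a_i,a_j\rangle=-\cos(\pi/m_{ij})\,\|a_i\|\,\|a_j\|$ for all $i,j$, and $(W,\{r_{a_1},\dots,r_{a_n}\})$ is a Coxeter system with Coxeter matrix $(m_{ij})$. -/

import Mathlib

namespace RootShell

open scoped RealInnerProductSpace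

/-- The ring `ℤ[φ]`, as a subring of the reals, where `φ = (1 + √5) / 2`. -/
noncomputable def goldenIntegers : Subalgebra ℤ ℝ := Algebra.adjoin ℤ {Real.goldenRatio}

/-- The Coxeter matrix of type `H₂ = I₂(5)`; Mathlib's `CoxeterMatrix.I m` is the matrix of the
dihedral type `I₂(m + 2)`. -/
def coxeterMatrixH2 : CoxeterMatrix (Fin 2) := CoxeterMatrix.I 3

theorem coxeterMatrixH2_apply :
    coxeterMatrixH2 0 1 = 5 ∧ coxeterMatrixH2 1 0 = 5 := by
  constructor <;> rfl

variable {V : Type*} [NormedAddCommGroup V] [InnerProductSpace ℝ V]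

/-- The Cartan coefficient `2⟨α, β⟩ / ⟨α, α⟩`. -/
noncomputable def cartanCoeff (α β : V) : ℝ := 2 * ⟪α, β⟫ / ⟪α, α⟫

/-- The orthogonal reflection in the hyperplane perpendicular to `α`. -/
noncomputable def refl (α : V) : V ≃ₗᵢ[ℝ] V := (ℝ ∙ α)ᗮ.reflection

theorem refl_apply (α x : V) : refl α x = x - (2 * ⟪x, α⟫ / ⟪α, α⟫) • α := by
  rw [refl, Submodule.reflection_orthogonal_apply, Submodule.reflection_singleton_apply,
    real_inner_self_eq_norm_sq, real_inner_comm α x, mul_div_assoc, mul_smul]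
  simp [two_smul]

/-- A finite single-length root-shell system in `V` with Cartan coefficients in the ring `R`. -/
structure IsRootShellSystem (R : Subalgebra ℤ ℝ) (T : Set V) : Prop where
  finite : T.Finite
  neg_mem : ∀ α ∈ T, -α ∈ T
  single_length : ∃ r : ℝ, 0 < r ∧ ∀ α ∈ T, ‖α‖ = r
  refl_mem : ∀ α ∈ T, ∀ β ∈ T, refl α β ∈ T
  cartanCoeff_mem : ∀ α ∈ T, ∀ β ∈ T, cartanCoeff α β ∈ R

/-- `T` is nonempty and is not the union of two nonempty mutually orthogonal subsets. -/
def IsIndecomposable (T : Set V) : Prop :=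
  T.Nonempty ∧ ∀ A B : Set V, A ∪ B = T → (∀ a ∈ A, ∀ b ∈ B, ⟪a, b⟫ = 0) → A = ∅ ∨ B = ∅

/-- Some Cartan coefficient is not an integer. -/
def IsNonCrystallographic (T : Set V) : Prop :=
  ∃ α ∈ T, ∃ β ∈ T, ∀ n : ℤ, cartanCoeff α β ≠ n

/-- The rank of `T` is the dimension of its real span. -/
noncomputable def rank (T : Set V) : ℕ := Module.finrank ℝ (Submodule.span ℝ T)

/-- The reflection group generated by the reflections in the elements of `T`. -/
def reflectionGroup (T : Set V) : Subgroup (V ≃ₗᵢ[ℝ] V) := Subgroup.closure (refl '' T)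

theorem refl_mem_reflectionGroup {T : Set V} {α : V} (hα : α ∈ T) :
    refl α ∈ reflectionGroup T :=
  Subgroup.subset_closure ⟨α, hα, rfl⟩

/-- The reflection group of `T` is the finite reflection group with Coxeter matrix `M`:
there are simple roots `a i` in `T` which form a basis of the span of `T` and enclose the angles
`π - π / M i j`, and the reflection group of `T`, together with the reflections in the simple
roots, is a Coxeter system of type `M`. -/
def HasCoxeterType {B : Type*} (T : Set V) (M : CoxeterMatrix B) : Prop :=
  ∃ (a : B → V) (ha : ∀ i, a i ∈ T),
    LinearIndependent ℝ a ∧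
    Submodule.span ℝ (Set.range a) = Submodule.span ℝ T ∧
    (∀ i j, ⟪a i, a j⟫ = -Real.cos (Real.pi / M i j) * (‖a i‖ * ‖a j‖)) ∧
    ∃ cs : CoxeterSystem M (reflectionGroup T),
      ∀ i, cs.simple i = ⟨refl (a i), refl_mem_reflectionGroup (ha i)⟩

end RootShell

namespace RootShell

open scoped RealInnerProductSpace goldenRatio

variable {V : Type*} [NormedAddCommGroup V] [InnerProductSpace ℝ V]

/-! ### Arithmetic of `ℤ[φ]` -/

/-! A Cartan coefficient of two roots at angle θ is 2 cos θ, and the pair β, -r_α(β) has the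
coefficient 2 cos 2θ = x² - 2. So the coefficients form a finite subset of ℤ[φ] stable under x ↦ x²
- 2. Since the Galois conjugation respects this map, the conjugates also lie in [-2, 2]; only 0, ±1,
±2, ±φ, ±(φ - 1) remain (`IsRootShellSystem.cartanCoeff_cases`). A simple system then has
off-diagonal coefficients 0, -1, -φ only, that is, edges labelled 2, 3, 5
(`IsSimpleSystem.cartanCoeff_cases`).

If no edge had label 5, all simple coefficients would be integers, and the roots, lying in the
ℤ-span of the simple ones, would be crystallographic (`cartanCoeff_int`). Indecomposability makes
the diagram connected (`exists_cartanCoeff_ne_zero`). Starting from an edge labelled 5, the diagram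
is grown one vertex at a time. Positive definiteness of the Gram matrix (`quadratic_pos`) excludes
every extension other than the paths H₂, H₃, H₄: each forbidden diagram has an explicit positive
vector of negative norm.

That the simple reflections present W is Tits' solution of the word problem. The number of inverted
positive roots is the word length, the exchange condition holds, and two reduced words of one
element are connected by braid relations (`wordProd_eq_of_reduced`). Hence the map from the abstract
Coxeter group to W has trivial kernel (`lift_injective`). -/

theorem exists_int_of_mem_goldenIntegers {x : ℝ} (hx : x ∈ goldenIntegers) :
    ∃ a b : ℤ, x = a + b * φ := by
  induction hx using Algebra.adjoin_induction with
  | mem x hx => exact ⟨0, 1, by simp_all⟩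
  | algebraMap n => exact ⟨n, 0, by simp⟩
  | add x y _ _ ihx ihy =>
    obtain ⟨a, b, rfl⟩ := ihx
    obtain ⟨c, d, rfl⟩ := ihy
    exact ⟨a + c, b + d, by push_cast; ring⟩
  | mul x y _ _ ihx ihy =>
    obtain ⟨a, b, rfl⟩ := ihx
    obtain ⟨c, d, rfl⟩ := ihy
    refine ⟨a * c + b * d, a * d + b * c + b * d, ?_⟩
    push_cast
    linear_combination (b * d : ℝ) * Real.goldenRatio_sq

/-- Irrationality of φ makes the coordinates unique, so that the conjugate a + bψ is a function of
the number a + bφ. -/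
theorem golden_int_injective :
    Function.Injective fun p : ℤ × ℤ ↦ (p.1 + p.2 * φ : ℝ) := by
  rintro ⟨a, b⟩ ⟨c, d⟩ h
  have h' : (a - c : ℝ) = (d - b) * φ := by simp only at h; linarith
  have hbd : d = b := by
    by_contra hne
    have hne' : (d - b : ℝ) ≠ 0 := sub_ne_zero.2 (by exact_mod_cast hne)
    refine Real.goldenRatio_irrational ⟨(a - c) / (d - b), ?_⟩
    push_cast
    rw [h', mul_div_cancel_left₀ _ hne']
  subst hbd
  simp only [sub_self, zero_mul, sub_eq_zero, Int.cast_inj] at h'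
  rw [h']

/-- In a finite subset of `ℤ[φ]` that is stable under `x ↦ x² - 2`, all Galois conjugates lie in
`[-2, 2]`. -/
theorem abs_golden_conj_le_two {C : Set ℝ} (hfin : C.Finite) (hC : ∀ x ∈ C, x ^ 2 - 2 ∈ C)
    {a b : ℤ} (hab : (a + b * φ : ℝ) ∈ C) : |(a + b * ψ : ℝ)| ≤ 2 := by
  set P : Set (ℤ × ℤ) := (fun p : ℤ × ℤ ↦ (p.1 + p.2 * φ : ℝ)) ⁻¹' C
  have hP : P.Finite := hfin.preimage golden_int_injective.injOn
  obtain ⟨⟨c, d⟩, hcd, hmax⟩ :=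
    P.exists_max_image (fun p ↦ |(p.1 + p.2 * ψ : ℝ)|) hP ⟨(a, b), hab⟩
  -- These are the coordinates of (c + dφ)² - 2. As (c, d) maximizes m = |c + dψ|, it follows that
  -- m² - 2 ≤ m, whence m ≤ 2.
  have key := hmax (c ^ 2 + d ^ 2 - 2, 2 * c * d + d ^ 2) (by
    change _ ∈ C
    convert! hC _ hcd using 1
    push_cast
    linear_combination -(d ^ 2 : ℝ) * Real.goldenRatio_sq)
  have hle := hmax (a, b) hab
  simp only at key hle
  have hsq : (((c ^ 2 + d ^ 2 - 2 : ℤ) : ℝ) + ((2 * c * d + d ^ 2 : ℤ) : ℝ) * ψ)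
      = |(c + d * ψ : ℝ)| ^ 2 - 2 := by
    rw [sq_abs]
    push_cast
    linear_combination -(d ^ 2 : ℝ) * Real.goldenConj_sq
  rw [hsq] at key
  have := le_abs_self (|(c + d * ψ : ℝ)| ^ 2 - 2)
  nlinarith [abs_nonneg (c + d * ψ : ℝ)]

/-- The difference of the two conjugates, b(2φ - 1), forces |b| ≤ 1, and their sum 2a + b then
forces |a| ≤ 2; the finitely many pairs are checked. -/
theorem golden_int_cases {a b : ℤ} (h : |(a + b * φ : ℝ)| ≤ 2) (h' : |(a + b * ψ : ℝ)| ≤ 2) :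
    (a + b * φ : ℝ) ∈ ({0, 1, -1, 2, -2, φ, -φ, φ - 1, 1 - φ} : Set ℝ) := by
  have hψ : ψ = 1 - φ := by linarith [Real.goldenRatio_add_goldenConj]
  have hφ := Real.goldenRatio_sq
  have h1 := Real.one_lt_goldenRatio
  have hφl : (3 / 2 : ℝ) < φ := by nlinarith
  have hφu : φ < (5 / 3 : ℝ) := by nlinarith
  rw [hψ, abs_le] at h'
  rw [abs_le] at h
  have hb1 : b < 2 := by
    by_contra hb
    have : (2 : ℝ) ≤ b := by exact_mod_cast not_lt.1 hb
    nlinarith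
  have hb2 : -2 < b := by
    by_contra hb
    have : (b : ℝ) ≤ -2 := by exact_mod_cast not_lt.1 hb
    nlinarith
  have hbR1 : (b : ℝ) ≤ 1 := by exact_mod_cast Int.lt_add_one_iff.1 hb1
  have hbR2 : (-1 : ℝ) ≤ b := by exact_mod_cast hb2
  have ha1 : a < 3 := by
    by_contra ha
    have : (3 : ℝ) ≤ a := by exact_mod_cast not_lt.1 ha
    nlinarith
  have ha2 : -3 < a := by
    by_contra ha
    have : (a : ℝ) ≤ -3 := by exact_mod_cast not_lt.1 ha
    nlinarith
  simp only [Set.mem_insert_iff, Set.mem_singleton_iff]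
  interval_cases b <;> interval_cases a <;> norm_num at h h' ⊢ <;>
    first
      | (exfalso; linarith)
      | grind

/-! ### Reflections -/

theorem refl_eq_sub_cartanCoeff (α x : V) : refl α x = x - cartanCoeff α x • α := by
  rw [refl_apply, cartanCoeff, real_inner_comm]

theorem refl_self (α : V) : refl α α = -α :=
  Submodule.reflection_orthogonalComplement_singleton_eq_neg α

@[simp]
theorem refl_mul_self (α : V) : refl α * refl α = 1 :=
  Submodule.reflection_mul_reflection _

@[simp]
theorem refl_mul_refl_mul (α : V) (g : V ≃ₗᵢ[ℝ] V) : refl α * (refl α * g) = g := by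
  rw [← mul_assoc, refl_mul_self, one_mul]

@[simp]
theorem mul_refl_mul_refl (α : V) (g : V ≃ₗᵢ[ℝ] V) : g * refl α * refl α = g := by
  rw [mul_assoc, refl_mul_self, mul_one]

@[simp]
theorem refl_inv (α : V) : (refl α)⁻¹ = refl α :=
  Submodule.reflection_inv

@[simp]
theorem refl_refl (α x : V) : refl α (refl α x) = x :=
  Submodule.reflection_reflection _ x

/-- Conjugating a reflection. -/
theorem mul_refl_eq (g : V ≃ₗᵢ[ℝ] V) (α : V) : g * refl α = refl (g α) * g := by
  ext x
  simp only [LinearIsometryEquiv.coe_mul, Function.comp_apply, refl_eq_sub_cartanCoeff, cartanCoeff, map_sub,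
    LinearIsometryEquiv.map_smul, LinearIsometryEquiv.inner_map_map]

theorem cartanCoeff_comm {α β : V} (h : ‖α‖ = ‖β‖) : cartanCoeff α β = cartanCoeff β α := by
  simp only [cartanCoeff, real_inner_self_eq_norm_sq, h, real_inner_comm]

theorem cartanCoeff_self {α : V} (h : α ≠ 0) : cartanCoeff α α = 2 := by
  rw [cartanCoeff, mul_div_assoc, div_self (by simpa using h), mul_one]

theorem abs_cartanCoeff_le_two {α β : V} (hα : α ≠ 0) (h : ‖α‖ = ‖β‖) :
    |cartanCoeff α β| ≤ 2 := by
  have hpos : 0 < ‖α‖ := norm_pos_iff.2 hα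
  rw [cartanCoeff, real_inner_self_eq_norm_sq, abs_div, abs_mul, abs_two,
    abs_of_pos (pow_pos hpos 2), div_le_iff₀ (pow_pos hpos 2)]
  have := abs_real_inner_le_norm α β
  rw [← h] at this
  nlinarith

namespace IsRootShellSystem

variable {R : Subalgebra ℤ ℝ} {T : Set V} (hT : IsRootShellSystem R T)
include hT

theorem norm_eq {α β : V} (hα : α ∈ T) (hβ : β ∈ T) : ‖α‖ = ‖β‖ := by
  obtain ⟨r, -, hr⟩ := hT.single_length
  rw [hr α hα, hr β hβ]

theorem ne_zero {α : V} (hα : α ∈ T) : α ≠ 0 := by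
  obtain ⟨r, hr0, hr⟩ := hT.single_length
  rw [← norm_pos_iff, hr α hα]
  exact hr0

theorem cartanCoeff_comm {α β : V} (hα : α ∈ T) (hβ : β ∈ T) :
    cartanCoeff α β = cartanCoeff β α :=
  RootShell.cartanCoeff_comm (hT.norm_eq hα hβ)

/-- Angle doubling: if β is at angle θ from α, then -r_α(β) is its mirror image in the line of α, at
angle 2θ from β. -/
theorem sq_sub_two_cartanCoeff {α β : V} (hα : α ∈ T) (hβ : β ∈ T) :
    ∃ γ ∈ T, ∃ δ ∈ T, cartanCoeff γ δ = cartanCoeff α β ^ 2 - 2 := by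
  refine ⟨β, hβ, -refl α β, hT.neg_mem _ (hT.refl_mem α hα β hβ), ?_⟩
  have hββ := cartanCoeff_self (hT.ne_zero hβ)
  have hc := hT.cartanCoeff_comm hα hβ
  have : cartanCoeff β (-refl α β) = cartanCoeff α β * cartanCoeff β α - cartanCoeff β β := by
    rw [refl_eq_sub_cartanCoeff]
    simp only [cartanCoeff, neg_sub, inner_sub_right, inner_smul_right]
    ring
  rw [this, hββ, ← hc]
  ring

end IsRootShellSystem

theorem IsRootShellSystem.cartanCoeff_cases {T : Set V} (hT : IsRootShellSystem goldenIntegers T)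
    {α β : V} (hα : α ∈ T) (hβ : β ∈ T) :
    cartanCoeff α β ∈ ({0, 1, -1, 2, -2, φ, -φ, φ - 1, 1 - φ} : Set ℝ) := by
  set C : Set ℝ := (fun p : V × V ↦ cartanCoeff p.1 p.2) '' (T ×ˢ T)
  have hfin : C.Finite := (hT.finite.prod hT.finite).image _
  have hC : ∀ x ∈ C, x ^ 2 - 2 ∈ C := by
    rintro _ ⟨⟨γ, δ⟩, ⟨hγ, hδ⟩, rfl⟩
    obtain ⟨γ', hγ', δ', hδ', h⟩ := hT.sq_sub_two_cartanCoeff hγ hδ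
    exact ⟨(γ', δ'), ⟨hγ', hδ'⟩, h⟩
  obtain ⟨a, b, hab⟩ := exists_int_of_mem_goldenIntegers (hT.cartanCoeff_mem α hα β hβ)
  have hmem : cartanCoeff α β ∈ C := ⟨(α, β), ⟨hα, hβ⟩, rfl⟩
  have habs := abs_cartanCoeff_le_two (hT.ne_zero hα) (hT.norm_eq hα hβ)
  rw [hab] at hmem habs ⊢
  exact golden_int_cases habs (abs_golden_conj_le_two hfin hC hmem)

/-! ### Simple systems -/

/-- The family `a` is the simple system of `T` with respect to the regular functional `f`. -/
structure IsSimpleSystem {B : Type*} [Fintype B] (T : Set V) (f : Module.Dual ℝ V) (a : B → V) :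
    Prop where
  mem : ∀ i, a i ∈ T
  pos : ∀ i, 0 < f (a i)
  linearIndependent : LinearIndependent ℝ a
  regular : ∀ β ∈ T, f β ≠ 0
  exists_coeff : ∀ β ∈ T, 0 < f β → ∃ c : B → ℝ, (∀ i, 0 ≤ c i) ∧ β = ∑ i, c i • a i

/-- `Δ` generates a cone which contains `P`. -/
def ConicallyGenerates (Δ P : Finset V) : Prop :=
  ∀ β ∈ P, ∃ c : V → ℝ, (∀ γ ∈ Δ, 0 ≤ c γ) ∧ β = ∑ γ ∈ Δ, c γ • γ

theorem ConicallyGenerates.erase [DecidableEq V] {Δ P : Finset V} (h : ConicallyGenerates Δ P)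
    {β : V} (hβ : β ∈ Δ) {d : V → ℝ} (hd : ∀ γ ∈ Δ.erase β, 0 ≤ d γ)
    (hsum : β = ∑ γ ∈ Δ.erase β, d γ • γ) : ConicallyGenerates (Δ.erase β) P := by
  intro x hx
  obtain ⟨c, hc, hxc⟩ := h x hx
  refine ⟨fun γ ↦ c β * d γ + c γ, fun γ hγ ↦ ?_, ?_⟩
  · exact add_nonneg (mul_nonneg (hc β hβ) (hd γ hγ)) (hc γ (Finset.mem_of_mem_erase hγ))
  · simp only [add_smul, mul_smul, Finset.sum_add_distrib, ← Finset.smul_sum]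
    rw [← hsum, hxc]
    exact (Finset.add_sum_erase _ (fun γ ↦ c γ • γ) hβ).symm

/-- A minimal set of generators of a cone in an open half-space admits no linear relation with
at most one negative coefficient, except for the trivial one. -/
theorem sum_smul_ne_zero_of_minimal [DecidableEq V] {Δ P : Finset V} {f : Module.Dual ℝ V}
    (hgen : ConicallyGenerates Δ P) (hf : ∀ γ ∈ Δ, 0 < f γ)
    (hmin : ∀ β ∈ Δ, ¬ ConicallyGenerates (Δ.erase β) P) {β γ₀ : V} (hβ : β ∈ Δ)
    (hγ₀ : γ₀ ∈ Δ.erase β) {e : V → ℝ} (he : ∀ γ ∈ Δ.erase β, 0 ≤ e γ) (he₀ : 0 < e γ₀) :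
    ∑ γ ∈ Δ, e γ • γ ≠ 0 := by
  intro hsum
  -- A negative coefficient lets β be solved for, so it is redundant as a generator; otherwise `f`
  -- is positive on the sum.
  rcases lt_or_ge (e β) 0 with hneg | hnn
  · refine hmin β hβ (hgen.erase hβ (d := fun γ ↦ e γ / (-e β)) (fun γ hγ ↦ ?_) ?_)
    · exact div_nonneg (he γ hγ) (by linarith)
    · rw [← Finset.add_sum_erase _ _ hβ] at hsum
      have h2 : ∑ γ ∈ Δ.erase β, e γ • γ = (-e β) • β := by
        rw [neg_smul]
        exact eq_neg_of_add_eq_zero_right hsum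
      have h3 : ∑ γ ∈ Δ.erase β, (e γ / (-e β)) • γ = (-e β)⁻¹ • ∑ γ ∈ Δ.erase β, e γ • γ := by
        rw [Finset.smul_sum]
        refine Finset.sum_congr rfl fun γ _ ↦ ?_
        rw [smul_smul, div_eq_inv_mul]
      rw [h3, h2, smul_smul, inv_mul_cancel₀ (by linarith), one_smul]
  · have h0 : ∑ γ ∈ Δ, e γ * f γ = 0 := by simpa using congrArg f hsum
    have hpos : 0 < ∑ γ ∈ Δ, e γ * f γ := by
      refine Finset.sum_pos' (fun γ hγ ↦ mul_nonneg ?_ (hf γ hγ).le)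
        ⟨γ₀, Finset.mem_of_mem_erase hγ₀, mul_pos he₀ (hf γ₀ (Finset.mem_of_mem_erase hγ₀))⟩
      by_cases hγβ : γ = β
      · rwa [hγβ]
      · exact he γ (Finset.mem_erase.2 ⟨hγβ, hγ⟩)
    exact hpos.ne' h0

theorem linearIndependent_of_inner_nonpos {ι : Type*} (f : Module.Dual ℝ V) (a : ι → V)
    (hpos : ∀ i, 0 < f (a i)) (hle : Pairwise fun i j ↦ ⟪a i, a j⟫ ≤ 0) :
    LinearIndependent ℝ a := by
  refine LinearMap.BilinForm.linearIndependent_of_pairwise_le_zero (innerₗ V) ?_ f a hpos hle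
  intro x hx
  exact real_inner_self_pos.2 hx

/-- A finite root system has a simple system. -/
theorem IsRootShellSystem.exists_isSimpleSystem {R : Subalgebra ℤ ℝ} {T : Set V}
    (hT : IsRootShellSystem R T) :
    ∃ (Δ : Finset V) (f : Module.Dual ℝ V), IsSimpleSystem T f (Subtype.val : Δ → V) := by
  classical
  have := hT.finite.to_subtype
  obtain ⟨f, hf⟩ : ∃ f : Module.Dual ℝ V, ∀ β : T, f β ≠ 0 :=
    Module.exists_dual_forall_apply_ne_zero _ fun β ↦ hT.ne_zero β.2
  set P : Finset V := hT.finite.toFinset.filter (0 < f ·) with hP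
  have hmemP {x : V} : x ∈ P ↔ x ∈ T ∧ 0 < f x := by simp [hP]
  obtain ⟨Δ, hΔ, hmin⟩ := Finset.exists_min_image (P.powerset.filter (ConicallyGenerates · P))
    Finset.card ⟨P, by
      simp only [Finset.mem_filter, Finset.mem_powerset, subset_rfl, true_and]
      intro β hβ
      exact ⟨fun γ ↦ if γ = β then 1 else 0, fun γ _ ↦ by dsimp only; split_ifs <;> simp,
        by simp [hβ]⟩⟩
  simp only [Finset.mem_filter, Finset.mem_powerset] at hΔ hmin
  obtain ⟨hΔP, hgen⟩ := hΔ
  have hmin' : ∀ β ∈ Δ, ¬ ConicallyGenerates (Δ.erase β) P := fun β hβ hc ↦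
    (Finset.card_erase_lt_of_mem hβ).not_ge
      (hmin _ ⟨(Finset.erase_subset _ _).trans hΔP, hc⟩)
  have hpos : ∀ γ ∈ Δ, 0 < f γ := fun γ hγ ↦ (hmemP.1 (hΔP hγ)).2
  have hmem : ∀ γ ∈ Δ, γ ∈ T := fun γ hγ ↦ (hmemP.1 (hΔP hγ)).1
  have hobtuse : ∀ α ∈ Δ, ∀ β ∈ Δ, α ≠ β → ⟪α, β⟫ ≤ 0 := by
    intro α hα β hβ hne
    -- At an acute angle, k > 0 and β - kα is a root. Whatever its sign, expanding it or its
    -- negative over `Δ` gives a linear relation in which only α, or only β, can have a negative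
    -- coefficient.
    by_contra! hinner
    have hk : 0 < cartanCoeff α β :=
      div_pos (by linarith) (real_inner_self_pos.2 (hT.ne_zero (hmem α hα)))
    set k := cartanCoeff α β
    have hρ : refl α β = β - k • α := refl_eq_sub_cartanCoeff α β
    have hρT := hT.refl_mem α (hmem α hα) β (hmem β hβ)
    rcases (hf ⟨_, hρT⟩).lt_or_gt with hneg | hpos'
    · obtain ⟨c, hc, hcs⟩ := hgen (-refl α β)
        (hmemP.2 ⟨hT.neg_mem _ hρT, by simpa using hneg⟩)
      refine sum_smul_ne_zero_of_minimal hgen hpos hmin' hα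
        (Finset.mem_erase.2 ⟨hne.symm, hβ⟩)
        (e := fun γ ↦ c γ + (if γ = β then 1 else 0) - (if γ = α then k else 0)) ?_ ?_ ?_
      · intro γ hγ
        have := hc γ (Finset.mem_of_mem_erase hγ)
        rw [if_neg (Finset.ne_of_mem_erase hγ)]
        split_ifs <;> linarith
      · have := hc β hβ
        simp only [if_true, if_neg hne.symm]
        linarith
      · simp only [add_smul, sub_smul, ite_smul, Finset.sum_add_distrib, Finset.sum_sub_distrib,
          Finset.sum_ite_eq', hα, hβ, if_true, zero_smul, one_smul, ← hcs, hρ]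
        abel
    · obtain ⟨c, hc, hcs⟩ := hgen (refl α β) (hmemP.2 ⟨hρT, hpos'⟩)
      refine sum_smul_ne_zero_of_minimal hgen hpos hmin' hβ
        (Finset.mem_erase.2 ⟨hne, hα⟩)
        (e := fun γ ↦ c γ + (if γ = α then k else 0) - (if γ = β then 1 else 0)) ?_ ?_ ?_
      · intro γ hγ
        have := hc γ (Finset.mem_of_mem_erase hγ)
        rw [if_neg (Finset.ne_of_mem_erase hγ)]
        split_ifs <;> linarith
      · have := hc α hα
        simp only [if_true, if_neg hne]
        linarith
      · simp only [add_smul, sub_smul, ite_smul, Finset.sum_add_distrib, Finset.sum_sub_distrib,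
          Finset.sum_ite_eq', hα, hβ, if_true, zero_smul, one_smul, ← hcs, hρ]
        abel
  refine ⟨Δ, f, fun i ↦ hmem _ i.2, fun i ↦ hpos _ i.2,
    linearIndependent_of_inner_nonpos f _ (fun i ↦ hpos _ i.2) fun i j hij ↦
      hobtuse _ i.2 _ j.2 (Subtype.coe_injective.ne hij), fun β hβ ↦ hf ⟨β, hβ⟩,
    fun β hβ hfβ ↦ ?_⟩
  obtain ⟨c, hc, hcs⟩ := hgen β (hmemP.2 ⟨hβ, hfβ⟩)
  refine ⟨fun i ↦ c i, fun i ↦ hc _ i.2, ?_⟩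
  rw [hcs]
  exact (Finset.sum_coe_sort Δ fun γ ↦ c γ • γ).symm

namespace IsSimpleSystem

variable {B : Type*} [Fintype B] {R : Subalgebra ℤ ℝ} {T : Set V} {f : Module.Dual ℝ V}
  {a : B → V}

theorem reindex {B' : Type*} [Fintype B'] (hS : IsSimpleSystem T f a) (e : B' ≃ B) :
    IsSimpleSystem T f (a ∘ e) where
  mem i := hS.mem _
  pos i := hS.pos _
  linearIndependent := hS.linearIndependent.comp _ e.injective
  regular := hS.regular
  exists_coeff β hβ hf := by
    obtain ⟨c, hc, h⟩ := hS.exists_coeff β hβ hf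
    exact ⟨c ∘ e, fun i ↦ hc _, h.trans (e.sum_comp fun i ↦ c i • a i).symm⟩

section

variable (hS : IsSimpleSystem T f a)
include hS

theorem coeff_unique {c d : B → ℝ} (h : ∑ i, c i • a i = ∑ i, d i • a i) : c = d := by
  have := Fintype.linearIndependent_iff.1 hS.linearIndependent (c - d) (by
    simp [sub_smul, Finset.sum_sub_distrib, h])
  ext i
  exact sub_eq_zero.1 (this i)

theorem coeff_nonneg {c : B → ℝ} (hmem : ∑ i, c i • a i ∈ T) (hpos : 0 < f (∑ i, c i • a i))
    (i : B) : 0 ≤ c i := by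
  obtain ⟨d, hd, h⟩ := hS.exists_coeff _ hmem hpos
  rw [hS.coeff_unique h]
  exact hd i

theorem coeff_pair_nonneg {i j : B} {x y : ℝ} (hij : i ≠ j) (hmem : x • a i + y • a j ∈ T)
    (hpos : 0 < f (x • a i + y • a j)) : 0 ≤ x ∧ 0 ≤ y := by
  classical
  have hexp : x • a i + y • a j
      = ∑ k, ((if k = i then x else 0) + (if k = j then y else 0)) • a k := by
    simp [add_smul, Finset.sum_add_distrib]
  rw [hexp] at hmem hpos
  have h1 := hS.coeff_nonneg hmem hpos i
  have h2 := hS.coeff_nonneg hmem hpos j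
  simp only [if_true, if_neg hij, if_neg hij.symm] at h1 h2
  exact ⟨by linarith, by linarith⟩

variable (hT : IsRootShellSystem R T)
include hT

/-- The reflection in `a i` alters only the i-th coordinate. If the image is negative, all other
coordinates of β vanish, and equal length leaves β = `a i`. -/
theorem refl_pos {β : V} (hβ : β ∈ T) (hfβ : 0 < f β) {i : B} (hne : β ≠ a i) :
    0 < f (refl (a i) β) := by
  classical
  obtain ⟨c, hc, hcβ⟩ := hS.exists_coeff β hβ hfβ
  have hρ := hT.refl_mem _ (hS.mem i) β hβ
  refine (hS.regular _ hρ).lt_or_gt.resolve_left fun hneg ↦ hne ?_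
  have hexp : -refl (a i) β
      = ∑ j, ((if j = i then cartanCoeff (a i) β else 0) - c j) • a j := by
    simp only [sub_smul, ite_smul, Finset.sum_sub_distrib, Finset.sum_ite_eq', Finset.mem_univ,
      if_true, zero_smul, ← hcβ, refl_eq_sub_cartanCoeff, neg_sub]
  have hzero : ∀ j, j ≠ i → c j = 0 := fun j hj ↦ by
    have := hS.coeff_nonneg (hexp ▸ hT.neg_mem _ hρ) (by rw [← hexp]; simpa using hneg) j
    rw [if_neg hj] at this
    linarith [hc j]
  have hβi : β = c i • a i := by
    rw [hcβ]
    exact Finset.sum_eq_single i (fun j _ hj ↦ by simp [hzero j hj]) (by simp)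
  have hnorm := hT.norm_eq hβ (hS.mem i)
  rw [hβi, norm_smul, Real.norm_of_nonneg (hc i)] at hnorm
  have : c i = 1 := mul_right_cancel₀ (norm_pos_iff.2 (hT.ne_zero (hS.mem i))).ne'
    (hnorm.trans (one_mul _).symm)
  rw [hβi, this, one_smul]

theorem cartanCoeff_nonpos {i j : B} (hij : i ≠ j) : cartanCoeff (a i) (a j) ≤ 0 := by
  have hne : a j ≠ a i := hS.linearIndependent.injective.ne hij.symm
  have hmem := hT.refl_mem _ (hS.mem i) _ (hS.mem j)
  have hpos := hS.refl_pos hT (hS.mem j) (hS.pos j) hne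
  have hexp : refl (a i) (a j) = (-cartanCoeff (a i) (a j)) • a i + (1 : ℝ) • a j := by
    rw [refl_eq_sub_cartanCoeff]; module
  rw [hexp] at hmem hpos
  linarith [(hS.coeff_pair_nonneg hij hmem hpos).1]

/-- Every root is obtained from a simple root by a sequence of simple reflections. -/
theorem root_induction {p : V → Prop} (simple : ∀ i, p (a i))
    (refl : ∀ i, ∀ β ∈ T, p β → p (refl (a i) β)) {β : V} (hβ : β ∈ T) : p β := by
  -- The descent runs over positive roots only, so both signs are carried along.
  suffices H : ∀ β ∈ {β ∈ T | 0 < f β}, p β ∧ p (-β) by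
    rcases (hS.regular β hβ).lt_or_gt with hneg | hpos
    · simpa using (H (-β) ⟨hT.neg_mem β hβ, by simpa using hneg⟩).2
    · exact (H β ⟨hβ, hpos⟩).1
  have hfin : {β ∈ T | 0 < f β}.Finite := hT.finite.subset fun _ h ↦ h.1
  by_contra! hcon
  obtain ⟨β₀, hβ₀, hβ₀'⟩ := hcon
  obtain ⟨β, ⟨⟨hβT, hβpos⟩, hβp⟩, hmin⟩ :=
    Set.exists_min_image {β | β ∈ {β ∈ T | 0 < f β} ∧ ¬ (p β ∧ p (-β))} f
      (hfin.subset fun _ h ↦ h.1) ⟨β₀, hβ₀, fun h ↦ hβ₀' h.1 h.2⟩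
  apply hβp
  by_cases hsimple : ∃ i, β = a i
  · obtain ⟨i, rfl⟩ := hsimple
    refine ⟨simple i, ?_⟩
    rw [← refl_self]
    exact refl i _ hβT (simple i)
  push Not at hsimple
  obtain ⟨c, hc, hcβ⟩ := hS.exists_coeff β hβT hβpos
  -- ⟪β, β⟫ > 0 is a nonnegative combination of the ⟪`a i`, β⟫. Reflecting in such an `a i` gives a
  -- positive root with a smaller value of `f`.
  obtain ⟨i, hi⟩ : ∃ i, 0 < ⟪a i, β⟫ := by
    by_contra! hle
    have h0 : 0 < ⟪β, β⟫ := real_inner_self_pos.2 (hT.ne_zero hβT)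
    have h1 : ⟪β, β⟫ = ∑ i, c i * ⟪a i, β⟫ := by
      conv_lhs => rw [hcβ, sum_inner, ← hcβ]
      simp [inner_smul_left]
    rw [h1] at h0
    exact h0.not_ge (Finset.sum_nonpos fun i _ ↦ mul_nonpos_of_nonneg_of_nonpos (hc i) (hle i))
  have hk : 0 < cartanCoeff (a i) β :=
    div_pos (by linarith) (real_inner_self_pos.2 (hT.ne_zero (hS.mem i)))
  have hρT := hT.refl_mem _ (hS.mem i) β hβT
  have hρpos := hS.refl_pos hT hβT hβpos (hsimple i)
  have hlt : f (RootShell.refl (a i) β) < f β := by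
    rw [refl_eq_sub_cartanCoeff, map_sub, map_smul, smul_eq_mul]
    linarith [mul_pos hk (hS.pos i)]
  have hρ : p (RootShell.refl (a i) β) ∧ p (-RootShell.refl (a i) β) := by
    by_contra hcon
    exact hlt.not_ge (hmin _ ⟨⟨hρT, hρpos⟩, hcon⟩)
  refine ⟨?_, ?_⟩
  · simpa using refl i _ hρT hρ.1
  · simpa using refl i _ (hT.neg_mem _ hρT) hρ.2

/-- By `root_induction`, since the reflection in r_i(β) is the conjugate of r_β by r_i. -/
theorem closure_range_refl :
    Subgroup.closure (Set.range fun i ↦ RootShell.refl (a i)) = reflectionGroup T := by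
  refine le_antisymm ((Subgroup.closure_le _).2 ?_) ((Subgroup.closure_le _).2 ?_)
  · rintro _ ⟨i, rfl⟩
    exact refl_mem_reflectionGroup (hS.mem i)
  · rintro _ ⟨β, hβ, rfl⟩
    refine hS.root_induction hT
      (p := fun β ↦ RootShell.refl β ∈ Subgroup.closure (Set.range fun i ↦ RootShell.refl (a i)))
      (fun i ↦ Subgroup.subset_closure ⟨i, rfl⟩) (fun i β _ h ↦ ?_) hβ
    have hi : RootShell.refl (a i) ∈ Subgroup.closure (Set.range fun i ↦ RootShell.refl (a i)) :=
      Subgroup.subset_closure ⟨i, rfl⟩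
    have := mul_refl_eq (RootShell.refl (a i)) β
    rw [← mul_inv_eq_iff_eq_mul.2 this]
    exact mul_mem (mul_mem hi h) (inv_mem hi)

theorem span_range : Submodule.span ℝ (Set.range a) = Submodule.span ℝ T := by
  refine le_antisymm (Submodule.span_mono (Set.range_subset_iff.2 hS.mem))
    (Submodule.span_le.2 fun β hβ ↦ ?_)
  have h {γ : V} (hγ : γ ∈ T) (hf : 0 < f γ) : γ ∈ Submodule.span ℝ (Set.range a) := by
    obtain ⟨c, -, rfl⟩ := hS.exists_coeff γ hγ hf
    exact Submodule.sum_mem _ fun i _ ↦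
      Submodule.smul_mem _ _ (Submodule.subset_span (Set.mem_range_self i))
  rcases (hS.regular β hβ).lt_or_gt with hneg | hpos
  · exact (Submodule.neg_mem_iff _).1 (h (hT.neg_mem β hβ) (by simpa using hneg))
  · exact h hβ hpos

theorem rank_eq : rank T = Fintype.card B := by
  rw [rank, ← hS.span_range hT, finrank_span_eq_card hS.linearIndependent]

end

/-- Two distinct simple roots of a system over `ℤ[φ]` enclose the angle `π - π / m` with
`m ∈ {2, 3, 5}`. -/
theorem cartanCoeff_cases (hS : IsSimpleSystem T f a) (hT : IsRootShellSystem goldenIntegers T)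
    {i j : B} (hij : i ≠ j) :
    cartanCoeff (a i) (a j) = 0 ∨ cartanCoeff (a i) (a j) = -1 ∨ cartanCoeff (a i) (a j) = -φ := by
  have hle := hS.cartanCoeff_nonpos hT hij
  have h1 := Real.one_lt_goldenRatio
  have hφ := Real.goldenRatio_sq
  have hii := hS.mem i
  have hjj := hS.mem j
  have hc := hT.cartanCoeff_comm hii hjj
  -- Equality in Cauchy–Schwarz: the two roots would be opposite, yet `f` is positive on both.
  have hne2 : cartanCoeff (a i) (a j) ≠ -2 := fun h ↦ by
    have hsum : a i + a j = 0 := by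
      rw [← norm_eq_zero, ← sq_eq_zero_iff, norm_add_sq_real]
      have hin : 2 * ⟪a i, a j⟫ = -2 * ‖a i‖ ^ 2 := by
        rw [cartanCoeff, real_inner_self_eq_norm_sq, div_eq_iff] at h
        · exact h
        · exact pow_ne_zero 2 (norm_ne_zero_iff.2 (hT.ne_zero hii))
      rw [hin, ← hT.norm_eq hii hjj]
      ring
    have : f (a i) + f (a j) = 0 := by rw [← map_add, hsum, map_zero]
    linarith [hS.pos i, hS.pos j]
  -- The angle 3π/5 is obtuse but not simple: r_i r_j(`a i`) would be a root with coordinates of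
  -- opposite signs.
  have hne : cartanCoeff (a i) (a j) ≠ 1 - φ := fun h ↦ by
    have hmem := hT.refl_mem _ hii _ (hT.refl_mem _ hjj _ hii)
    have hexp : refl (a i) (refl (a j) (a i)) = (1 - φ) • a i + (φ - 1) • a j := by
      rw [refl_eq_sub_cartanCoeff (a j), ← hc, h, map_sub, LinearIsometryEquiv.map_smul, refl_self,
        refl_eq_sub_cartanCoeff, h]
      have : (1 - φ) * (1 - φ) = 1 + (1 - φ) := by linarith
      match_scalars <;> linarith
    rcases (hS.regular _ hmem).lt_or_gt with hneg | hpos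
    · have hmem' := hT.neg_mem _ hmem
      have hexp' : -refl (a i) (refl (a j) (a i)) = (φ - 1) • a i + (1 - φ) • a j := by
        rw [hexp]; module
      have hpos : 0 < f (-refl (a i) (refl (a j) (a i))) := by simpa using hneg
      rw [hexp'] at hmem' hpos
      linarith [(hS.coeff_pair_nonneg hij hmem' hpos).2]
    · rw [hexp] at hmem hpos
      linarith [(hS.coeff_pair_nonneg hij hmem hpos).1]
  have := hT.cartanCoeff_cases hii hjj
  simp only [Set.mem_insert_iff, Set.mem_singleton_iff] at this
  rcases this with h | h | h | h | h | h | h | h | h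
  · exact Or.inl h
  · linarith
  · exact Or.inr (Or.inl h)
  · linarith
  · exact absurd h hne2
  · linarith
  · exact Or.inr (Or.inr h)
  · linarith
  · exact absurd h hne

end IsSimpleSystem

/-! ### Braid relations of involutions -/

section Involutions

variable {G : Type*} [Group G] {x y : G} (hx : x * x = 1) (hy : y * y = 1)
include hx hy

theorem mul_pow_two_eq_one_iff : (x * y) ^ 2 = 1 ↔ x * y = y * x := by
  have hx' : x⁻¹ = x := inv_eq_of_mul_eq_one_left hx
  have hy' : y⁻¹ = y := inv_eq_of_mul_eq_one_left hy
  have h : (x * y) ^ 2 = (x * y) * (x * y) := pow_two _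
  rw [h, mul_eq_one_iff_eq_inv]
  simp only [mul_inv_rev, hx', hy']

theorem mul_pow_three_eq_one_iff : (x * y) ^ 3 = 1 ↔ x * y * x = y * x * y := by
  have hx' : x⁻¹ = x := inv_eq_of_mul_eq_one_left hx
  have hy' : y⁻¹ = y := inv_eq_of_mul_eq_one_left hy
  have h : (x * y) ^ 3 = (x * y * x) * (y * x * y) := by
    simp only [pow_succ, pow_zero, one_mul, mul_assoc]
  rw [h, mul_eq_one_iff_eq_inv]
  simp only [mul_inv_rev, hx', hy', mul_assoc]

theorem mul_pow_five_eq_one_iff : (x * y) ^ 5 = 1 ↔ x * y * x * y * x = y * x * y * x * y := by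
  have hx' : x⁻¹ = x := inv_eq_of_mul_eq_one_left hx
  have hy' : y⁻¹ = y := inv_eq_of_mul_eq_one_left hy
  have h : (x * y) ^ 5 = (x * y * x * y * x) * (y * x * y * x * y) := by
    simp only [pow_succ, pow_zero, one_mul, mul_assoc]
  rw [h, mul_eq_one_iff_eq_inv]
  simp only [mul_inv_rev, hx', hy', mul_assoc]

end Involutions

/-! ### Braid relations of reflections -/

theorem refl_eq_self {x y : V} (h : cartanCoeff x y = 0) : refl x y = y := by
  rw [refl_eq_sub_cartanCoeff, h]; module

theorem refl_eq_add {x y : V} (h : cartanCoeff x y = -1) : refl x y = x + y := by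
  rw [refl_eq_sub_cartanCoeff, h]; module

theorem refl_eq_golden_add {x y : V} (h : cartanCoeff x y = -φ) : refl x y = φ • x + y := by
  rw [refl_eq_sub_cartanCoeff, h]; module

theorem refl_refl_of_eq_neg_one {x y : V} (hxy : cartanCoeff x y = -1)
    (hyx : cartanCoeff y x = -1) : refl x (refl y x) = y := by
  rw [refl_eq_add hyx, map_add, refl_self, refl_eq_add hxy]
  abel

section GoldenPair

variable {x y : V} (hxy : cartanCoeff x y = -φ) (hyx : cartanCoeff y x = -φ)
include hxy hyx

/-- With its two successors this runs through the positive roots of the pentagonal dihedral system.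
Their coefficients are nonnegative, so an isometry making x and y negative makes all of them
negative. -/
theorem refl_refl_golden : refl x (refl y x) = φ • x + φ • y := by
  rw [refl_eq_golden_add hyx, map_add, LinearIsometryEquiv.map_smul, refl_self,
    refl_eq_golden_add hxy]
  have := Real.goldenRatio_sq
  match_scalars <;> linarith

theorem refl_refl_refl_golden : refl x (refl y (refl x y)) = x + φ • y := by
  rw [refl_refl_golden hyx hxy, map_add, LinearIsometryEquiv.map_smul,
    LinearIsometryEquiv.map_smul, refl_self, refl_eq_golden_add hxy]
  have := Real.goldenRatio_sq
  match_scalars <;> linarith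

theorem refl_refl_refl_refl_golden : refl x (refl y (refl x (refl y x))) = y := by
  rw [refl_refl_refl_golden hyx hxy, map_add, LinearIsometryEquiv.map_smul, refl_self,
    refl_eq_golden_add hxy]
  module

end GoldenPair

theorem refl_mul_refl_comm {x y : V} (h : cartanCoeff x y = 0) :
    refl x * refl y = refl y * refl x := by
  rw [mul_refl_eq, refl_eq_self h]

theorem refl_braid_three {x y : V} (hxy : cartanCoeff x y = -1) (hyx : cartanCoeff y x = -1) :
    refl x * refl y * refl x = refl y * refl x * refl y := by
  rw [mul_refl_eq (refl x * refl y), LinearIsometryEquiv.coe_mul, Function.comp_apply,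
    refl_refl_of_eq_neg_one hxy hyx, mul_assoc]

/-- The product r_x r_y r_x r_y takes x to y, hence conjugates r_x into r_y. -/
theorem refl_braid_five {x y : V} (hxy : cartanCoeff x y = -φ) (hyx : cartanCoeff y x = -φ) :
    refl x * refl y * refl x * refl y * refl x = refl y * refl x * refl y * refl x * refl y := by
  rw [mul_refl_eq (refl x * refl y * refl x * refl y)]
  simp only [LinearIsometryEquiv.coe_mul, Function.comp_apply,
    refl_refl_refl_refl_golden hxy hyx, mul_assoc]

/-! ### Inversions, reduced words and the Coxeter presentation -/

theorem reflectionGroup_apply_mem {R : Subalgebra ℤ ℝ} {T : Set V} (hT : IsRootShellSystem R T)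
    {w : V ≃ₗᵢ[ℝ] V} (hw : w ∈ reflectionGroup T) {β : V} (hβ : β ∈ T) : w β ∈ T := by
  induction hw using Subgroup.closure_induction_left generalizing β with
  | one => exact hβ
  | mul_left x hx y _ ih =>
    obtain ⟨α, hα, rfl⟩ := hx
    exact hT.refl_mem α hα _ (ih hβ)
  | inv_mul_cancel x hx y _ ih =>
    obtain ⟨α, hα, rfl⟩ := hx
    rw [refl_inv]
    exact hT.refl_mem α hα _ (ih hβ)

/-- The number of positive roots that `w` makes negative. -/
noncomputable def inversionCount (T : Set V) (f : Module.Dual ℝ V) (w : V ≃ₗᵢ[ℝ] V) : ℕ :=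
  {β | β ∈ T ∧ 0 < f β ∧ f (w β) < 0}.ncard

/-- The product of the elements `s i`, where `i` runs through a word. -/
def wordProd {B G : Type*} [Monoid G] (s : B → G) (ω : List B) : G := (ω.map s).prod

section wordProd

variable {B G : Type*}

@[simp]
theorem wordProd_nil [Monoid G] (s : B → G) : wordProd s [] = 1 := by simp [wordProd]

@[simp]
theorem wordProd_cons [Monoid G] (s : B → G) (i : B) (ω : List B) :
    wordProd s (i :: ω) = s i * wordProd s ω := by simp [wordProd]

@[simp]
theorem wordProd_append [Monoid G] (s : B → G) (ω ω' : List B) :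
    wordProd s (ω ++ ω') = wordProd s ω * wordProd s ω' := by simp [wordProd]

theorem wordProd_mul_wordProd_reverse [Group G] {s : B → G} (hs : ∀ i, s i * s i = 1)
    (ω : List B) : wordProd s ω * wordProd s ω.reverse = 1 := by
  induction ω with
  | nil => simp
  | cons i ω ih =>
    have : s i * wordProd s ω * (wordProd s ω.reverse * s i)
        = s i * (wordProd s ω * wordProd s ω.reverse) * s i := by simp only [mul_assoc]
    simp [this, ih, hs]

end wordProd

/-- The Coxeter matrix `M` describes the angles between the vectors `a i`, all of which are
`π / 2`, `2π / 3` or `4π / 5`. -/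
def IsGoldenCoxeterMatrix {B : Type*} (a : B → V) (M : CoxeterMatrix B) : Prop :=
  ∀ i j, i ≠ j → M i j = 2 ∧ cartanCoeff (a i) (a j) = 0 ∨
    M i j = 3 ∧ cartanCoeff (a i) (a j) = -1 ∨ M i j = 5 ∧ cartanCoeff (a i) (a j) = -φ

namespace IsSimpleSystem

variable {B : Type*} [Fintype B] {R : Subalgebra ℤ ℝ} {T : Set V} {f : Module.Dual ℝ V}
  {a : B → V} (hS : IsSimpleSystem T f a)
include hS

theorem wordProd_refl_mem (ω : List B) :
    wordProd (fun i ↦ refl (a i)) ω ∈ reflectionGroup T := by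
  induction ω with
  | nil => exact one_mem _
  | cons i ω ih =>
    rw [wordProd_cons]
    exact mul_mem (refl_mem_reflectionGroup (hS.mem i)) ih

variable (hT : IsRootShellSystem R T)
include hT

theorem cartanCoeff_comm (i j : B) : cartanCoeff (a i) (a j) = cartanCoeff (a j) (a i) :=
  hT.cartanCoeff_comm (hS.mem i) (hS.mem j)

/-- The reflection in `a i` permutes the positive roots other than `a i`, so inversions correspond,
and `a i` itself becomes a new one. -/
theorem inversionCount_mul_refl_of_pos {w : V ≃ₗᵢ[ℝ] V} {i : B} (hpos : 0 < f (w (a i))) :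
    inversionCount T f (w * refl (a i)) = inversionCount T f w + 1 := by
  have hset : {β | β ∈ T ∧ 0 < f β ∧ f ((w * refl (a i)) β) < 0}
      = insert (a i) (refl (a i) '' {β | β ∈ T ∧ 0 < f β ∧ f (w β) < 0}) := by
    ext β
    simp only [Set.mem_ofPred_eq, Set.mem_insert_iff, LinearIsometryEquiv.coe_mul,
      Function.comp_apply, Set.mem_image]
    constructor
    · rintro ⟨hβ, hfβ, hneg⟩
      by_cases hi : β = a i
      · exact Or.inl hi
      · exact Or.inr ⟨refl (a i) β, ⟨hT.refl_mem _ (hS.mem i) _ hβ, hS.refl_pos hT hβ hfβ hi,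
          hneg⟩, refl_refl _ _⟩
    · rintro (rfl | ⟨γ, ⟨hγ, hfγ, hneg⟩, rfl⟩)
      · exact ⟨hS.mem i, hS.pos i, by simpa [refl_self] using hpos⟩
      · refine ⟨hT.refl_mem _ (hS.mem i) _ hγ, hS.refl_pos hT hγ hfγ ?_, by simpa using hneg⟩
        rintro rfl
        exact hneg.not_gt hpos
  have hfin : {β | β ∈ T ∧ 0 < f β ∧ f (w β) < 0}.Finite := hT.finite.subset fun _ h ↦ h.1
  rw [inversionCount, inversionCount, hset, Set.ncard_insert_of_notMem _ (hfin.image _),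
    Set.ncard_image_of_injective _ (refl (a i)).injective]
  rintro ⟨γ, ⟨-, hfγ, -⟩, h⟩
  have : γ = -a i := by rw [← refl_self, ← refl_refl (a i) γ, h]
  rw [this, map_neg] at hfγ
  linarith [hS.pos i]

theorem inversionCount_mul_refl_of_neg {w : V ≃ₗᵢ[ℝ] V} {i : B} (hneg : f (w (a i)) < 0) :
    inversionCount T f (w * refl (a i)) + 1 = inversionCount T f w := by
  rw [← hS.inversionCount_mul_refl_of_pos hT (i := i) (by simpa [refl_self] using hneg),
    mul_refl_mul_refl]

theorem wordProd_apply_ne_zero (ω : List B) (i : B) :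
    f (wordProd (fun i ↦ refl (a i)) ω (a i)) ≠ 0 :=
  hS.regular _ (reflectionGroup_apply_mem hT (hS.wordProd_refl_mem ω) (hS.mem i))

theorem inversionCount_wordProd_le (ω : List B) :
    inversionCount T f (wordProd (fun i ↦ refl (a i)) ω) ≤ ω.length := by
  induction ω using List.reverseRecOn with
  | nil =>
    have : {β | β ∈ T ∧ 0 < f β ∧ f β < 0} = ∅ :=
      Set.eq_empty_iff_forall_notMem.2 fun β h ↦ h.2.1.not_gt h.2.2
    simp [inversionCount, this]
  | append_singleton ω i ih =>
    simp only [wordProd_append, wordProd_cons, wordProd_nil, mul_one, List.length_append,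
      List.length_singleton]
    rcases (hS.wordProd_apply_ne_zero hT ω i).lt_or_gt with hneg | hpos
    · have := hS.inversionCount_mul_refl_of_neg hT hneg
      lia
    · have := hS.inversionCount_mul_refl_of_pos hT hpos
      lia

/-- The exchange condition. -/
theorem exists_exchange (ω : List B) (i : B)
    (hneg : f (wordProd (fun i ↦ refl (a i)) ω (a i)) < 0) :
    ∃ ω' : List B, ω'.length + 1 = ω.length ∧
      wordProd (fun i ↦ refl (a i)) ω' = wordProd (fun i ↦ refl (a i)) ω * refl (a i) := by
  induction ω with
  | nil => exact absurd hneg (by simpa using (hS.pos i).le)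
  | cons j ω ih =>
    rcases (hS.wordProd_apply_ne_zero hT ω i).lt_or_gt with hneg' | hpos
    · obtain ⟨ω', hlen, hω'⟩ := ih hneg'
      exact ⟨j :: ω', by simp [hlen], by simp [hω', mul_assoc]⟩
    · have hmem := reflectionGroup_apply_mem hT (hS.wordProd_refl_mem ω) (hS.mem i)
      -- The letter j turns a positive root negative, so that root is `a j`. Conjugation then gives
      -- r_j ω r_i = ω: the letter j is deleted.
      have heq : wordProd (fun i ↦ refl (a i)) ω (a i) = a j := by
        by_contra hne
        have := hS.refl_pos hT hmem hpos hne
        simp only [wordProd_cons, LinearIsometryEquiv.coe_mul, Function.comp_apply] at hneg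
        exact this.not_gt hneg
      refine ⟨ω, by simp, ?_⟩
      rw [wordProd_cons, mul_assoc, mul_refl_eq, heq, refl_mul_refl_mul]

/-- Appending a letter either adds an inversion or, by exchange, shortens the word. -/
theorem exists_reduced_word (ω : List B) :
    ∃ ω' : List B, wordProd (fun i ↦ refl (a i)) ω' = wordProd (fun i ↦ refl (a i)) ω ∧
      ω'.length = inversionCount T f (wordProd (fun i ↦ refl (a i)) ω) := by
  induction ω using List.reverseRecOn with
  | nil => exact ⟨[], rfl, (Nat.le_zero.1 (hS.inversionCount_wordProd_le hT [])).symm⟩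
  | append_singleton ω i ih =>
    obtain ⟨ω₁, hω₁, hlen⟩ := ih
    simp only [wordProd_append, wordProd_cons, wordProd_nil, mul_one, ← hω₁] at hlen ⊢
    rcases (hS.wordProd_apply_ne_zero hT ω₁ i).lt_or_gt with hneg | hpos
    · obtain ⟨ω', hlen', hω'⟩ := hS.exists_exchange hT ω₁ i hneg
      have := hS.inversionCount_mul_refl_of_neg hT hneg
      exact ⟨ω', hω', by lia⟩
    · have := hS.inversionCount_mul_refl_of_pos hT hpos
      exact ⟨ω₁ ++ [i], by simp, by simp; lia⟩

variable {M : CoxeterMatrix B} (hM : IsGoldenCoxeterMatrix a M)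
include hM

theorem isLiftable_refl : M.IsLiftable fun i ↦ refl (a i) := by
  intro i j
  by_cases hij : i = j
  · simp [hij]
  have hc := hS.cartanCoeff_comm hT i j
  rcases hM i j hij with ⟨hm, h⟩ | ⟨hm, h⟩ | ⟨hm, h⟩
  · rw [hm, mul_pow_two_eq_one_iff (refl_mul_self _) (refl_mul_self _)]
    exact refl_mul_refl_comm h
  · rw [hm, mul_pow_three_eq_one_iff (refl_mul_self _) (refl_mul_self _)]
    exact refl_braid_three h (hc ▸ h)
  · rw [hm, mul_pow_five_eq_one_iff (refl_mul_self _) (refl_mul_self _)]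
    exact refl_braid_five h (hc ▸ h)

/-- If `w` makes two simple roots `a i` and `a j` negative, then the longest element of the
dihedral group generated by their reflections can be split off from `w`. -/
theorem exists_dihedral_factor {G : Type*} [Group G] {s : B → G} (hs : M.IsLiftable s) {i j : B}
    (hij : i ≠ j) {w : V ≃ₗᵢ[ℝ] V} (hi : f (w (a i)) < 0) (hj : f (w (a j)) < 0) :
    ∃ p q : List B, p.length = q.length ∧
      wordProd (fun i ↦ refl (a i)) (p ++ [i]) = wordProd (fun i ↦ refl (a i)) (q ++ [j]) ∧
      wordProd s (p ++ [i]) = wordProd s (q ++ [j]) ∧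
      inversionCount T f (w * wordProd (fun i ↦ refl (a i)) (p ++ [i]).reverse) + (p.length + 1)
        = inversionCount T f w := by
  have hc := hS.cartanCoeff_comm hT i j
  have hss : ∀ k, s k * s k = 1 := fun k ↦ by simpa using hs k k
  have step {u : V ≃ₗᵢ[ℝ] V} {k : B} (h : f (u (a k)) < 0) :
      inversionCount T f (u * refl (a k)) + 1 = inversionCount T f u :=
    hS.inversionCount_mul_refl_of_neg hT h
  rcases hM i j hij with ⟨hm, h⟩ | ⟨hm, h⟩ | ⟨hm, h⟩
  -- In each case `p ++ [i]` and `q ++ [j]` are the two alternating words of length `M i j`.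
  -- Multiplying by the reversed word removes one inversion per letter, as w makes all positive
  -- roots of the dihedral subsystem negative.
  · have hsb := (mul_pow_two_eq_one_iff (hss i) (hss j)).1 (hm ▸ hs i j)
    refine ⟨[j], [i], rfl, ?_, ?_, ?_⟩
    · simpa using (refl_mul_refl_comm h).symm
    · simpa using hsb.symm
    · have e1 := step hi
      have e2 := step (u := w * refl (a i)) (k := j) (by simpa [refl_eq_self h] using hj)
      simp [← mul_assoc]
      lia
  · have hsb := (mul_pow_three_eq_one_iff (hss i) (hss j)).1 (hm ▸ hs i j)
    have h' := hc ▸ h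
    refine ⟨[i, j], [j, i], rfl, ?_, ?_, ?_⟩
    · simpa [mul_assoc] using refl_braid_three h h'
    · simpa [mul_assoc] using hsb
    · have e1 := step hi
      have e2 := step (u := w * refl (a i)) (k := j) (by
        simp [refl_eq_add h]; linarith)
      have e3 := step (u := w * refl (a i) * refl (a j)) (k := i) (by
        simpa [refl_refl_of_eq_neg_one h h'] using hj)
      simp [← mul_assoc]
      lia
  · have hsb := (mul_pow_five_eq_one_iff (hss i) (hss j)).1 (hm ▸ hs i j)
    have h' := hc ▸ h
    have hφ := Real.goldenRatio_pos
    have hi' := mul_neg_of_pos_of_neg hφ hi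
    have hj' := mul_neg_of_pos_of_neg hφ hj
    refine ⟨[i, j, i, j], [j, i, j, i], rfl, ?_, ?_, ?_⟩
    · simpa [mul_assoc] using refl_braid_five h h'
    · simpa [mul_assoc] using hsb
    · have e1 := step hi
      have e2 := step (u := w * refl (a i)) (k := j) (by
        simp [refl_eq_golden_add h]; linarith)
      have e3 := step (u := w * refl (a i) * refl (a j)) (k := i) (by
        simp [refl_refl_golden h h']; linarith)
      have e4 := step (u := w * refl (a i) * refl (a j) * refl (a i)) (k := j) (by
        simp [refl_refl_refl_golden h h']; linarith)
      have e5 := step (u := w * refl (a i) * refl (a j) * refl (a i) * refl (a j)) (k := i) (by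
        simpa [refl_refl_refl_refl_golden h h'] using hj)
      simp [← mul_assoc]
      lia

/-- Two reduced words for the same element of the reflection group have the same product in every
group in which the braid relations hold. -/
theorem wordProd_eq_of_reduced {G : Type*} [Group G] {s : B → G} (hs : M.IsLiftable s)
    {n : ℕ} {ω ω' : List B} (hlen : ω.length = n) (hlen' : ω'.length = n)
    (hred : inversionCount T f (wordProd (fun i ↦ refl (a i)) ω) = n)
    (heq : wordProd (fun i ↦ refl (a i)) ω = wordProd (fun i ↦ refl (a i)) ω') :
    wordProd s ω = wordProd s ω' := by
  induction n generalizing ω ω' with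
  | zero => rw [List.length_eq_zero_iff.1 hlen, List.length_eq_zero_iff.1 hlen']
  | succ n ih =>
    have split {ω : List B} (hlen : ω.length = n + 1)
        (hred : inversionCount T f (wordProd (fun i ↦ refl (a i)) ω) = n + 1) :
        ∃ ω₁ i, ω = ω₁ ++ [i] ∧ ω₁.length = n ∧
          inversionCount T f (wordProd (fun i ↦ refl (a i)) ω₁) = n ∧
          f (wordProd (fun i ↦ refl (a i)) ω (a i)) < 0 := by
      rcases List.eq_nil_or_concat' ω with rfl | ⟨ω₁, i, rfl⟩
      · simp at hlen
      have hlen₁ : ω₁.length = n := by simpa using hlen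
      have hle := hS.inversionCount_wordProd_le hT ω₁
      simp only [wordProd_append, wordProd_cons, wordProd_nil, mul_one] at hred
      rcases (hS.wordProd_apply_ne_zero hT ω₁ i).lt_or_gt with hneg | hpos
      · have := hS.inversionCount_mul_refl_of_neg hT hneg
        lia
      · have := hS.inversionCount_mul_refl_of_pos hT hpos
        exact ⟨ω₁, i, rfl, hlen₁, by lia, by simpa [refl_self] using hpos⟩
    obtain ⟨ω₁, i, rfl, hlen₁, hred₁, hi⟩ := split hlen hred
    obtain ⟨ω₂, j, rfl, hlen₂, hred₂, hj⟩ := split hlen' (heq ▸ hred)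
    by_cases hij : i = j
    · subst hij
      have : wordProd (fun i ↦ refl (a i)) ω₁ = wordProd (fun i ↦ refl (a i)) ω₂ := by
        simpa using heq
      simp [ih hlen₁ hlen₂ hred₁ this]
    rw [← heq] at hj
    obtain ⟨p, q, hpq, hρ, hσ, hcount⟩ := hS.exists_dihedral_factor hT hM hs hij hi hj
    rw [← wordProd_append] at hcount
    -- Both final letters are descents, so the element is υ times the longest dihedral element.
    -- Induction compares ω₁ with υp and ω₂ with υq, which share their last letters i and j; the
    -- braid relation identifies υpi with υqj.
    obtain ⟨υ, hυ, hυlen⟩ := hS.exists_reduced_word hT (ω₁ ++ [i] ++ (p ++ [i]).reverse)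
    have hυ' : wordProd (fun i ↦ refl (a i)) (υ ++ (p ++ [i]))
        = wordProd (fun i ↦ refl (a i)) (ω₁ ++ [i]) := by
      have := wordProd_mul_wordProd_reverse (fun i ↦ refl_mul_self (a i)) (p ++ [i]).reverse
      rw [List.reverse_reverse] at this
      rw [wordProd_append, hυ, wordProd_append, mul_assoc, this, mul_one]
    have h₁ : wordProd s ω₁ = wordProd s (υ ++ p) := by
      refine ih hlen₁ (by simp; lia) hred₁ (mul_right_cancel (b := refl (a i)) ?_)
      simpa [mul_assoc] using hυ'.symm
    have h₂ : wordProd s ω₂ = wordProd s (υ ++ q) := by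
      refine ih hlen₂ (by simp; lia) hred₂ (mul_right_cancel (b := refl (a j)) ?_)
      rw [wordProd_append, hρ, heq] at hυ'
      simpa [mul_assoc] using hυ'.symm
    calc wordProd s (ω₁ ++ [i]) = wordProd s υ * wordProd s (p ++ [i]) := by
          simp [h₁, mul_assoc]
      _ = wordProd s (ω₂ ++ [j]) := by rw [hσ]; simp [h₂, mul_assoc]

theorem exists_reduced_word_eq {G : Type*} [Group G] {s : B → G} (hs : M.IsLiftable s)
    (ω : List B) :
    ∃ ω' : List B, wordProd (fun i ↦ refl (a i)) ω' = wordProd (fun i ↦ refl (a i)) ω ∧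
      ω'.length = inversionCount T f (wordProd (fun i ↦ refl (a i)) ω) ∧
      wordProd s ω' = wordProd s ω := by
  have hss : ∀ k, s k * s k = 1 := fun k ↦ by simpa using hs k k
  induction ω using List.reverseRecOn with
  | nil => exact ⟨[], rfl, (Nat.le_zero.1 (hS.inversionCount_wordProd_le hT [])).symm, rfl⟩
  | append_singleton ω i ih =>
    obtain ⟨ω₁, hω₁, hlen, hs₁⟩ := ih
    simp only [wordProd_append, wordProd_cons, wordProd_nil, mul_one, ← hω₁, ← hs₁] at hlen ⊢
    rcases (hS.wordProd_apply_ne_zero hT ω₁ i).lt_or_gt with hneg | hpos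
    · obtain ⟨ω', hlen', hω'⟩ := hS.exists_exchange hT ω₁ i hneg
      have := hS.inversionCount_mul_refl_of_neg hT hneg
      -- ω₁ and ω'i are reduced words of the same element, so their images under `s` agree, and the
      -- square of `s i` cancels.
      have heq := hS.wordProd_eq_of_reduced hT hM hs (ω := ω₁) (ω' := ω' ++ [i]) rfl
        (by simp [hlen']) hlen.symm (by simp [hω'])
      exact ⟨ω', hω', by lia, by simp [heq, mul_assoc, hss]⟩
    · have := hS.inversionCount_mul_refl_of_pos hT hpos
      exact ⟨ω₁ ++ [i], by simp, by simp; lia, by simp⟩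

theorem lift_injective :
    Function.Injective (M.toCoxeterSystem.lift ⟨_, hS.isLiftable_refl hT hM⟩) := by
  rw [injective_iff_map_eq_one]
  intro g hg
  obtain ⟨ω, rfl⟩ := M.toCoxeterSystem.wordProd_surjective g
  have hs : M.IsLiftable M.toCoxeterSystem.simple := M.toCoxeterSystem.simple_mul_simple_pow
  have hρ (ω : List B) : M.toCoxeterSystem.lift ⟨_, hS.isLiftable_refl hT hM⟩
      (M.toCoxeterSystem.wordProd ω) = wordProd (fun i ↦ refl (a i)) ω := by
    induction ω with
    | nil => simp
    | cons i ω ih => simp only [CoxeterSystem.wordProd_cons, map_mul, ih, wordProd_cons,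
        CoxeterSystem.lift_apply_simple]
  -- Here `s` is the family of abstract Coxeter generators. A word in the kernel has the same
  -- abstract product as a reduced word of length 0.
  obtain ⟨ω', hω', hlen, hsω'⟩ := hS.exists_reduced_word_eq hT hM hs ω
  rw [← hρ, hg] at hlen
  have hzero : inversionCount T f 1 = 0 := by
    simpa using hS.inversionCount_wordProd_le hT []
  rw [hzero, List.length_eq_zero_iff] at hlen
  rw [hlen, wordProd_nil] at hsω'
  exact hsω'.symm

theorem range_lift :
    (M.toCoxeterSystem.lift ⟨_, hS.isLiftable_refl hT hM⟩).range = reflectionGroup T := by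
  rw [← hS.closure_range_refl hT, MonoidHom.range_eq_map,
    ← M.toCoxeterSystem.subgroup_closure_range_simple, MonoidHom.map_closure, ← Set.range_comp]
  congr 2

/-- The reflections in the simple roots make the reflection group a Coxeter system. -/
theorem exists_coxeterSystem :
    ∃ cs : CoxeterSystem M (reflectionGroup T),
      ∀ i, cs.simple i = ⟨refl (a i), refl_mem_reflectionGroup (hS.mem i)⟩ := by
  refine ⟨M.toCoxeterSystem.map ((MonoidHom.ofInjective (hS.lift_injective hT hM)).trans
    (MulEquiv.subgroupCongr (hS.range_lift hT hM))), fun i ↦ Subtype.ext ?_⟩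
  exact CoxeterSystem.lift_apply_simple _ (hS.isLiftable_refl hT hM) i

theorem inner_eq (i j : B) :
    ⟪a i, a j⟫ = -Real.cos (Real.pi / M i j) * (‖a i‖ * ‖a j‖) := by
  by_cases hij : i = j
  · subst hij
    simp [sq]
  have hne : ⟪a i, a i⟫ ≠ 0 := (real_inner_self_pos.2 (hT.ne_zero (hS.mem i))).ne'
  have hn := hT.norm_eq (hS.mem i) (hS.mem j)
  rw [← hn, ← sq, ← real_inner_self_eq_norm_sq]
  rcases hM i j hij with ⟨hm, h⟩ | ⟨hm, h⟩ | ⟨hm, h⟩ <;>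
    rw [cartanCoeff, div_eq_iff hne] at h <;> rw [hm] <;> push_cast
  · rw [Real.cos_pi_div_two]
    linarith
  · rw [Real.cos_pi_div_three]
    linarith
  · rw [Real.cos_pi_div_five]
    simp only [Real.goldenRatio] at h
    linarith

theorem hasCoxeterType : HasCoxeterType T M :=
  ⟨a, hS.mem, hS.linearIndependent, hS.span_range hT, hS.inner_eq hT hM,
    hS.exists_coxeterSystem hT hM⟩

end IsSimpleSystem

/-! ### Connected diagrams, integrality and the Gram form -/

theorem coxeterMatrixH2_apply_of_ne {i j : Fin 2} (h : i ≠ j) : coxeterMatrixH2 i j = 5 := by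
  simp [coxeterMatrixH2, CoxeterMatrix.I, h]

theorem inner_eq_zero_of_cartanCoeff_eq_zero {x y : V} (hx : x ≠ 0) (h : cartanCoeff x y = 0) :
    ⟪x, y⟫ = 0 := by
  rw [cartanCoeff, div_eq_zero_iff] at h
  rcases h with h | h
  · linarith
  · exact absurd (inner_self_eq_zero.1 h) hx

theorem sum_sum_eq_diag_add_two_mul_sum_lt {ι : Type*} [Fintype ι] [LinearOrder ι] {F : ι → ι → ℝ}
    (hF : ∀ p q, F p q = F q p) :
    ∑ p, ∑ q, F p q = ∑ p, F p p + 2 * ∑ p, ∑ q, if p < q then F p q else 0 := by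
  have h1 : ∀ p q, F p q = (if p = q then F p q else 0) + (if p < q then F p q else 0)
      + (if q < p then F p q else 0) := by
    intro p q
    rcases lt_trichotomy p q with h | h | h
    · simp [h, h.ne, h.not_gt]
    · simp [h]
    · simp [h, h.ne', h.not_gt]
  have h2 : ∑ p, ∑ q, (if q < p then F p q else 0) = ∑ p, ∑ q, if p < q then F p q else 0 := by
    rw [Finset.sum_comm]
    simp only [fun p q ↦ hF q p]
  calc ∑ p, ∑ q, F p q = ∑ p, ∑ q, ((if p = q then F p q else 0) + (if p < q then F p q else 0)
        + (if q < p then F p q else 0)) := by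
        exact Finset.sum_congr rfl fun p _ ↦ Finset.sum_congr rfl fun q _ ↦ h1 p q
    _ = _ := by
        simp only [Finset.sum_add_distrib, h2]
        simp
        ring

namespace IsSimpleSystem

variable {B : Type*} [Fintype B] {R : Subalgebra ℤ ℝ} {T : Set V} {f : Module.Dual ℝ V}
  {a : B → V}

section

variable (hS : IsSimpleSystem T f a) (hT : IsRootShellSystem R T)
include hS hT

/-- The simple roots of an indecomposable system form a connected diagram. -/
theorem exists_cartanCoeff_ne_zero (hind : IsIndecomposable T) {S : Set B} (hne : S.Nonempty)
    (hne' : Sᶜ.Nonempty) : ∃ i ∈ S, ∃ j ∉ S, cartanCoeff (a i) (a j) ≠ 0 := by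
  by_contra! hcon
  -- Without an edge the two spans are orthogonal and stable under all simple reflections, so each
  -- root lies in one of them and T splits.
  have hortho : Submodule.span ℝ (a '' S) ⟂ Submodule.span ℝ (a '' Sᶜ) := by
    rw [Submodule.isOrtho_span]
    rintro _ ⟨i, hi, rfl⟩ _ ⟨j, hj, rfl⟩
    exact inner_eq_zero_of_cartanCoeff_eq_zero (hT.ne_zero (hS.mem i)) (hcon i hi j hj)
  have hfix {N N' : Submodule ℝ V} (hN : N ⟂ N') {i : B} (hi : a i ∈ N ∨ a i ∈ N') {β : V}
      (hβ : β ∈ N) : refl (a i) β ∈ N := by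
    rw [refl_eq_sub_cartanCoeff]
    rcases hi with hi | hi
    · exact N.sub_mem hβ (N.smul_mem _ hi)
    · have : cartanCoeff (a i) β = 0 := by
        rw [cartanCoeff, Submodule.isOrtho_iff_inner_eq.1 hN.symm _ hi _ hβ]
        simp
      simpa [this] using hβ
  have hmem (i : B) :
      a i ∈ Submodule.span ℝ (a '' S) ∨ a i ∈ Submodule.span ℝ (a '' Sᶜ) := by
    by_cases hi : i ∈ S
    · exact Or.inl (Submodule.subset_span ⟨i, hi, rfl⟩)
    · exact Or.inr (Submodule.subset_span ⟨i, hi, rfl⟩)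
  have hcover : ∀ β ∈ T,
      β ∈ Submodule.span ℝ (a '' S) ∨ β ∈ Submodule.span ℝ (a '' Sᶜ) := fun β hβ ↦
    hS.root_induction hT
      (p := fun β ↦ β ∈ Submodule.span ℝ (a '' S) ∨ β ∈ Submodule.span ℝ (a '' Sᶜ)) hmem
      (fun i β _ h ↦ h.imp (hfix hortho (hmem i)) (hfix hortho.symm (hmem i).symm)) hβ
  obtain ⟨i, hi⟩ := hne
  obtain ⟨j, hj⟩ := hne'
  rcases hind.2 (T ∩ Submodule.span ℝ (a '' S)) (T ∩ Submodule.span ℝ (a '' Sᶜ)) (by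
      rw [← Set.inter_union_distrib_left, Set.inter_eq_left]
      exact hcover)
    (fun x hx y hy ↦ Submodule.isOrtho_iff_inner_eq.1 hortho _ hx.2 _ hy.2) with h | h
  · exact (h ▸ ⟨hS.mem i, Submodule.subset_span ⟨i, hi, rfl⟩⟩ : a i ∈ (∅ : Set V))
  · exact (h ▸ ⟨hS.mem j, Submodule.subset_span ⟨j, hj, rfl⟩⟩ : a j ∈ (∅ : Set V))

/-- If the Cartan coefficients of the simple roots are integers, then so are all of them. -/
theorem cartanCoeff_int (hsimple : ∀ i j, ∃ n : ℤ, cartanCoeff (a i) (a j) = n) {α β : V}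
    (hα : α ∈ T) (hβ : β ∈ T) : ∃ n : ℤ, cartanCoeff α β = n := by
  have hspan (i : B) {β : V} (hβ : β ∈ Submodule.span ℤ (Set.range a)) :
      ∃ n : ℤ, cartanCoeff (a i) β = n := by
    induction hβ using Submodule.span_induction with
    | mem x hx =>
      obtain ⟨j, rfl⟩ := hx
      exact hsimple i j
    | zero => exact ⟨0, by simp [cartanCoeff]⟩
    | add x y _ _ hx hy =>
      obtain ⟨m, hm⟩ := hx
      obtain ⟨n, hn⟩ := hy
      refine ⟨m + n, ?_⟩
      push_cast
      rw [← hm, ← hn]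
      simp only [cartanCoeff, inner_add_right]
      ring
    | smul k x _ hx =>
      obtain ⟨m, hm⟩ := hx
      refine ⟨k * m, ?_⟩
      push_cast
      rw [← hm, ← Int.cast_smul_eq_zsmul ℝ]
      simp only [cartanCoeff, inner_smul_right]
      ring
  have hlattice : ∀ β ∈ T, β ∈ Submodule.span ℤ (Set.range a) := fun β hβ ↦ by
    refine hS.root_induction hT (p := (· ∈ Submodule.span ℤ (Set.range a)))
      (fun i ↦ Submodule.subset_span ⟨i, rfl⟩) (fun i β _ h ↦ ?_) hβ
    obtain ⟨n, hn⟩ := hspan i h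
    rw [refl_eq_sub_cartanCoeff, hn, Int.cast_smul_eq_zsmul]
    exact Submodule.sub_mem _ h (Submodule.smul_mem _ _ (Submodule.subset_span ⟨i, rfl⟩))
  -- Reflections are self-adjoint isometries, so the first argument can be moved to a simple root,
  -- where the lattice statement applies.
  refine hS.root_induction hT (p := fun α ↦ ∀ β ∈ T, ∃ n : ℤ, cartanCoeff α β = n)
    (fun i β hβ ↦ hspan i (hlattice β hβ)) (fun i α _ h β hβ ↦ ?_) hα β hβ
  obtain ⟨n, hn⟩ := h _ (hT.refl_mem _ (hS.mem i) β hβ)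
  refine ⟨n, ?_⟩
  rw [← hn]
  have (x y : V) : ⟪refl (a i) x, y⟫ = ⟪x, refl (a i) y⟫ := by
    rw [← LinearIsometryEquiv.inner_map_map (refl (a i)), refl_refl]
  simp only [cartanCoeff, this, refl_refl]

/-- The Gram matrix of the simple roots is positive definite; increasing its entries off the
diagonal preserves the positivity at vectors with nonnegative coordinates. -/
theorem quadratic_pos {n : ℕ} {g : Fin n → B} (hg : Function.Injective g) {x : Fin n → ℝ}
    (hx : ∀ p, 0 ≤ x p) (hx' : ∃ p, x p ≠ 0) {A : Fin n → Fin n → ℝ}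
    (hA : ∀ p q, p < q → cartanCoeff (a (g p)) (a (g q)) ≤ A p q) :
    0 < ∑ p, x p ^ 2 + ∑ p, ∑ q, if p < q then x p * x q * A p q else 0 := by
  obtain ⟨r, hr, hnorm⟩ := hT.single_length
  set u := ∑ p, x p • a (g p) with hu
  have hu0 : u ≠ 0 := fun h ↦ by
    obtain ⟨p, hp⟩ := hx'
    exact hp (Fintype.linearIndependent_iff.1 (hS.linearIndependent.comp g hg) x h p)
  have hin (i j : B) : ⟪a i, a j⟫ = r ^ 2 / 2 * cartanCoeff (a i) (a j) := by
    rw [cartanCoeff, real_inner_self_eq_norm_sq, hnorm _ (hS.mem i)]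
    field_simp
  have h1 : 0 < ⟪u, u⟫ := real_inner_self_pos.2 hu0
  have h2 : ⟪u, u⟫
      = r ^ 2 / 2 * ∑ p, ∑ q, x p * x q * cartanCoeff (a (g p)) (a (g q)) := by
    simp only [hu, sum_inner, inner_sum, inner_smul_left, inner_smul_right, hin, Finset.mul_sum]
    refine Finset.sum_congr rfl fun p _ ↦ Finset.sum_congr rfl fun q _ ↦ ?_
    rw [hS.cartanCoeff_comm hT (g q) (g p)]
    simp only [conj_trivial]
    ring
  rw [h2, sum_sum_eq_diag_add_two_mul_sum_lt (fun p q ↦ by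
    rw [hS.cartanCoeff_comm hT, mul_comm (x p)])] at h1
  have h3 := pos_of_mul_pos_right h1 (by positivity)
  have h4 : ∑ p, x p * x p * cartanCoeff (a (g p)) (a (g p)) = 2 * ∑ p, x p ^ 2 := by
    rw [Finset.mul_sum]
    refine Finset.sum_congr rfl fun p _ ↦ ?_
    rw [cartanCoeff_self (hT.ne_zero (hS.mem _))]
    ring
  have h5 : ∑ p, ∑ q, (if p < q then x p * x q * cartanCoeff (a (g p)) (a (g q)) else 0)
      ≤ ∑ p, ∑ q, if p < q then x p * x q * A p q else 0 := by
    refine Finset.sum_le_sum fun p _ ↦ Finset.sum_le_sum fun q _ ↦ ?_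
    split_ifs with h
    · exact mul_le_mul_of_nonneg_left (hA p q h) (mul_nonneg (hx p) (hx q))
    · exact le_rfl
  linarith

end

/-! ### Diagrams that do not occur -/

section Forbidden

variable {B : Type*} [Fintype B] {R : Subalgebra ℤ ℝ} {T : Set V} {f : Module.Dual ℝ V}
  {a : B → V} (hS : IsSimpleSystem T f a) (hT : IsRootShellSystem R T) {x y z w u : B}
include hS hT

/-- A variant of `quadratic_pos` for a list of pairwise distinct simple roots. -/
theorem quadratic_pos_list {n : ℕ} {g : Fin n → B} (hd : (List.ofFn g).Nodup) {x : Fin n → ℝ}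
    (hx : ∀ p, 0 < x p) (hn : 0 < n) {A : Fin n → Fin n → ℝ}
    (hA : ∀ p q, p < q → A p q = 0 ∨ cartanCoeff (a (g p)) (a (g q)) ≤ A p q) :
    0 < ∑ p, x p ^ 2 + ∑ p, ∑ q, if p < q then x p * x q * A p q else 0 := by
  have hg := List.nodup_ofFn.1 hd
  refine hS.quadratic_pos hT hg (fun p ↦ (hx p).le) ⟨⟨0, hn⟩, (hx _).ne'⟩ fun p q hpq ↦ ?_
  -- The entry 0 is always admissible, because simple Cartan coefficients are nonpositive. A
  -- forbidden diagram thus lists only edges that must be present; extra edges do no harm.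
  rcases hA p q hpq with h | h
  · exact h ▸ hS.cartanCoeff_nonpos hT (hg.ne hpq.ne)
  · exact h

/-- No simple root is joined to two others by edges with label 5. -/
theorem not_golden_path_golden_golden (hd : [x, y, z].Nodup)
    (hxy : cartanCoeff (a x) (a y) = -φ)
    (hyz : cartanCoeff (a y) (a z) = -φ) : False := by
  have hφ := Real.goldenRatio_sq
  have h1 := Real.one_lt_goldenRatio
  generalize φ = t at *
  have ht : 0 < t := by linarith
  -- The middle coordinate t minimizes the form for end coordinates 1; the value is 2 - t² = 1 - t <
  -- 0.
  have := hS.quadratic_pos_list hT (g := ![x, y, z]) (by simpa using hd)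
    (x := ![1, t, 1]) (by intro p; fin_cases p <;> simp [ht]) (by norm_num)
    (A := ![![0, -t, 0], ![0, 0, -t], ![0, 0, 0]]) (by
      intro p q hpq
      fin_cases p <;> fin_cases q <;>
        first
          | exact absurd hpq (by decide)
          | (left; simp; done)
          | (right; simp; linarith))
  simp [Fin.sum_univ_succ] at this
  nlinarith

/-- An edge with label 5 is not part of a triangle. -/
theorem not_golden_triangle (hd : [x, y, z].Nodup)
    (hxy : cartanCoeff (a x) (a y) = -φ)
    (hxz : cartanCoeff (a x) (a z) ≤ -1)
    (hyz : cartanCoeff (a y) (a z) ≤ -1) : False := by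
  have hφ := Real.goldenRatio_sq
  have h1 := Real.one_lt_goldenRatio
  generalize φ = t at *
  have ht : 0 < t := by linarith
  have := hS.quadratic_pos_list hT (g := ![x, y, z]) (by simpa using hd)
    (x := ![1, 1, 1]) (by intro p; fin_cases p <;> simp) (by norm_num)
    (A := ![![0, -t, -1], ![0, 0, -1], ![0, 0, 0]]) (by
      intro p q hpq
      fin_cases p <;> fin_cases q <;>
        first
          | exact absurd hpq (by decide)
          | (left; simp; done)
          | (right; simp; linarith))
  simp [Fin.sum_univ_succ] at this
  nlinarith

/-- An edge with label 5 has no neighbours at both ends. -/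
theorem not_golden_middle_edge (hd : [z, y, x, w].Nodup)
    (hzy : cartanCoeff (a z) (a y) ≤ -1)
    (hyx : cartanCoeff (a y) (a x) = -φ)
    (hxw : cartanCoeff (a x) (a w) ≤ -1) : False := by
  have hφ := Real.goldenRatio_sq
  have h1 := Real.one_lt_goldenRatio
  generalize φ = t at *
  have ht : 0 < t := by linarith
  have := hS.quadratic_pos_list hT (g := ![z, y, x, w]) (by simpa using hd)
    (x := ![1, 2, 2, 1]) (by intro p; fin_cases p <;> simp) (by norm_num)
    (A := ![![0, -1, 0, 0], ![0, 0, -t, 0], ![0, 0, 0, -1], ![0, 0, 0, 0]]) (by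
      intro p q hpq
      fin_cases p <;> fin_cases q <;>
        first
          | exact absurd hpq (by decide)
          | (left; simp; done)
          | (right; simp; linarith))
  simp [Fin.sum_univ_succ] at this
  nlinarith

/-- An end of an edge with label 5 is not a branch point. -/
theorem not_golden_fork (hd : [x, y, z, w].Nodup)
    (hxy : cartanCoeff (a x) (a y) = -φ)
    (hyz : cartanCoeff (a y) (a z) ≤ -1)
    (hyw : cartanCoeff (a y) (a w) ≤ -1) : False := by
  have hφ := Real.goldenRatio_sq
  have h1 := Real.one_lt_goldenRatio
  generalize φ = t at *
  have ht : 0 < t := by linarith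
  -- Each leaf gets half its edge weight times its neighbour's coordinate, the minimizing choice;
  -- the value is again 2 - t².
  have := hS.quadratic_pos_list hT (g := ![x, y, z, w]) (by simpa using hd)
    (x := ![t, 2, 1, 1]) (by intro p; fin_cases p <;> simp [ht]) (by norm_num)
    (A := ![![0, -t, 0, 0], ![0, 0, -1, -1], ![0, 0, 0, 0], ![0, 0, 0, 0]]) (by
      intro p q hpq
      fin_cases p <;> fin_cases q <;>
        first
          | exact absurd hpq (by decide)
          | (left; simp; done)
          | (right; simp; linarith))
  simp [Fin.sum_univ_succ] at this
  nlinarith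

/-- Two edges with label 5 are not joined by an edge. -/
theorem not_golden_both_ends (hd : [x, y, z, w].Nodup)
    (hxy : cartanCoeff (a x) (a y) = -φ)
    (hyz : cartanCoeff (a y) (a z) ≤ -1)
    (hzw : cartanCoeff (a z) (a w) = -φ) : False := by
  have hφ := Real.goldenRatio_sq
  have h1 := Real.one_lt_goldenRatio
  generalize φ = t at *
  have ht : 0 < t := by linarith
  have := hS.quadratic_pos_list hT (g := ![x, y, z, w]) (by simpa using hd)
    (x := ![t, 2, 2, t]) (by intro p; fin_cases p <;> simp [ht]) (by norm_num)
    (A := ![![0, -t, 0, 0], ![0, 0, -1, 0], ![0, 0, 0, -t], ![0, 0, 0, 0]]) (by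
      intro p q hpq
      fin_cases p <;> fin_cases q <;>
        first
          | exact absurd hpq (by decide)
          | (left; simp; done)
          | (right; simp; linarith))
  simp [Fin.sum_univ_succ] at this
  nlinarith

/-- A neighbour of an edge with label 5 is not a branch point. -/
theorem not_golden_path_fork (hd : [x, y, z, w, u].Nodup)
    (hxy : cartanCoeff (a x) (a y) = -φ)
    (hyz : cartanCoeff (a y) (a z) ≤ -1)
    (hzw : cartanCoeff (a z) (a w) ≤ -1)
    (hzu : cartanCoeff (a z) (a u) ≤ -1) : False := by
  have hφ := Real.goldenRatio_sq
  have h1 := Real.one_lt_goldenRatio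
  generalize φ = t at *
  have ht : 0 < t := by linarith
  have := hS.quadratic_pos_list hT (g := ![x, y, z, w, u]) (by simpa using hd)
    (x := ![t, 2, 2, 1, 1]) (by intro p; fin_cases p <;> simp [ht]) (by norm_num)
    (A := ![![0, -t, 0, 0, 0], ![0, 0, -1, 0, 0], ![0, 0, 0, -1, -1], ![0, 0, 0, 0, 0], ![0, 0, 0, 0, 0]]) (by
      intro p q hpq
      fin_cases p <;> fin_cases q <;>
        first
          | exact absurd hpq (by decide)
          | (left; simp; done)
          | (right; simp; linarith))
  simp [Fin.sum_univ_succ] at this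
  nlinarith

/-- There is no path on five simple roots that begins with an edge with label 5. -/
theorem not_golden_path_five (hd : [x, y, z, w, u].Nodup)
    (hxy : cartanCoeff (a x) (a y) = -φ)
    (hyz : cartanCoeff (a y) (a z) ≤ -1)
    (hzw : cartanCoeff (a z) (a w) ≤ -1)
    (hwu : cartanCoeff (a w) (a u) ≤ -1) : False := by
  have hφ := Real.goldenRatio_sq
  have h1 := Real.one_lt_goldenRatio
  generalize φ = t at *
  have ht : 0 < t := by linarith
  -- The tail 4, 3, 2, 1 is linear and the leaf `x` gets 4t/2; the value is 10 - 4t² = 6 - 4t < 0.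
  have := hS.quadratic_pos_list hT (g := ![x, y, z, w, u]) (by simpa using hd)
    (x := ![2 * t, 4, 3, 2, 1]) (by intro p; fin_cases p <;> simp [ht]) (by norm_num)
    (A := ![![0, -t, 0, 0, 0], ![0, 0, -1, 0, 0], ![0, 0, 0, -1, 0], ![0, 0, 0, 0, -1], ![0, 0, 0, 0, 0]]) (by
      intro p q hpq
      fin_cases p <;> fin_cases q <;>
        first
          | exact absurd hpq (by decide)
          | (left; simp; done)
          | (right; simp; linarith))
  simp [Fin.sum_univ_succ] at this
  nlinarith

end Forbidden

end IsSimpleSystem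

/-! ### Classification -/

namespace IsSimpleSystem

variable {B : Type*} [Fintype B] {T : Set V} {f : Module.Dual ℝ V} {a : B → V}

theorem exists_golden_edge (hS : IsSimpleSystem T f a) (hT : IsRootShellSystem goldenIntegers T)
    (hnc : IsNonCrystallographic T) :
    ∃ x y, x ≠ y ∧ cartanCoeff (a x) (a y) = -φ := by
  by_contra! hcon
  obtain ⟨α, hα, β, hβ, hαβ⟩ := hnc
  obtain ⟨n, hn⟩ := hS.cartanCoeff_int hT (fun i j ↦ by
    by_cases hij : i = j
    · exact ⟨2, by rw [hij, cartanCoeff_self (hT.ne_zero (hS.mem j))]; norm_num⟩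
    rcases hS.cartanCoeff_cases hT hij with h | h | h
    · exact ⟨0, by simp [h]⟩
    · exact ⟨-1, by simp [h]⟩
    · exact absurd h (hcon i j hij)) hα hβ
  exact hαβ n hn

theorem hasCoxeterType_of_bijective {R : Subalgebra ℤ ℝ} (hS : IsSimpleSystem T f a)
    (hT : IsRootShellSystem R T) {n : ℕ} {g : Fin n → B} (hg : Function.Bijective g)
    {M : CoxeterMatrix (Fin n)} (hM : ∀ i j, i < j →
      M i j = 2 ∧ cartanCoeff (a (g i)) (a (g j)) = 0 ∨
      M i j = 3 ∧ cartanCoeff (a (g i)) (a (g j)) = -1 ∨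
      M i j = 5 ∧ cartanCoeff (a (g i)) (a (g j)) = -φ) :
    rank T = n ∧ HasCoxeterType T M := by
  refine ⟨by rw [hS.rank_eq hT, ← Fintype.card_of_bijective hg, Fintype.card_fin],
    (hS.reindex (Equiv.ofBijective g hg)).hasCoxeterType hT fun i j hij ↦ ?_⟩
  simp only [Function.comp_apply, Equiv.ofBijective_apply]
  rcases hij.lt_or_gt with h | h
  · exact hM i j h
  · rw [M.symmetric, hS.cartanCoeff_comm hT]
    exact hM j i h

variable (hS : IsSimpleSystem T f a) (hT : IsRootShellSystem goldenIntegers T)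
  (hind : IsIndecomposable T)
include hS hT hind

theorem hasCoxeterType_of_golden_path {x y z : B} (hd : [x, y, z].Nodup)
    (hxy : cartanCoeff (a x) (a y) = -φ) (hyz : cartanCoeff (a y) (a z) ≠ 0) :
    rank T = 3 ∧ HasCoxeterType T CoxeterMatrix.H₃ ∨
      rank T = 4 ∧ HasCoxeterType T CoxeterMatrix.H₄ := by
  have hcomm := hS.cartanCoeff_comm hT
  have hφ := Real.one_lt_goldenRatio
  have hle {i j : B} (hij : i ≠ j) (h : cartanCoeff (a i) (a j) ≠ 0) :
      cartanCoeff (a i) (a j) ≤ -1 := by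
    rcases hS.cartanCoeff_cases hT hij with h' | h' | h'
    · exact absurd h' h
    · exact h'.le
    · rw [h']; linarith
  have hd' := hd
  simp only [List.nodup_cons, List.mem_cons, List.not_mem_nil, or_false, not_or,
    List.nodup_nil, not_false_eq_true, and_true] at hd'
  obtain ⟨⟨nxy, nxz⟩, nyz⟩ := hd'
  have hyz1 : cartanCoeff (a y) (a z) = -1 := by
    rcases hS.cartanCoeff_cases hT nyz with h | h | h
    · exact absurd h hyz
    · exact h
    · exact (hS.not_golden_path_golden_golden hT hd hxy h).elim
  have hxz0 : cartanCoeff (a x) (a z) = 0 := by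
    by_contra h
    exact hS.not_golden_triangle hT hd hxy (hle nxz h) hyz1.le
  by_cases hall : ∀ i, i = x ∨ i = y ∨ i = z
  · left
    -- The order is reversed because the edge labelled 5 comes last in `CoxeterMatrix.H₃`.
    refine hS.hasCoxeterType_of_bijective hT (g := ![z, y, x]) ⟨?_, fun i ↦ ?_⟩ ?_
    · rw [← List.nodup_ofFn]
      simp [Ne.symm nxy, Ne.symm nxz, Ne.symm nyz]
    · rcases hall i with rfl | rfl | rfl
      exacts [⟨2, rfl⟩, ⟨1, rfl⟩, ⟨0, rfl⟩]
    · intro i j hij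
      fin_cases i <;> fin_cases j <;>
        first
          | exact absurd hij (by decide)
          | simp [CoxeterMatrix.H₃, hcomm z, hcomm y x, hxz0, hyz1, hxy]
  right
  push Not at hall
  obtain ⟨w₀, hw₀⟩ := hall
  -- Connectedness attaches a fourth vertex; the forbidden diagrams leave `z` as the only place,
  -- with label 3.
  obtain ⟨i, hi, w, hw, hiw⟩ := hS.exists_cartanCoeff_ne_zero hT hind (S := {x, y, z})
    ⟨x, by simp⟩ ⟨w₀, by simpa using hw₀⟩
  simp only [Set.mem_insert_iff, Set.mem_singleton_iff, not_or] at hi hw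
  obtain ⟨nwx, nwy, nwz⟩ := hw
  have hd4 : [x, y, z, w].Nodup := by
    simp [nxy, nxz, nyz, Ne.symm nwx, Ne.symm nwy, Ne.symm nwz]
  have hnx {w : B} (nwx : w ≠ x) (nwy : w ≠ y) (nwz : w ≠ z) : cartanCoeff (a x) (a w) = 0 := by
    by_contra h
    refine hS.not_golden_middle_edge hT (z := z) (y := y) (x := x) (w := w) ?_
      (hcomm z y ▸ hyz1.le) (hcomm y x ▸ hxy) (hle nwx.symm h)
    simp [Ne.symm nxy, Ne.symm nxz, Ne.symm nyz, nwx.symm, nwy.symm, nwz.symm]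
  have hny {w : B} (nwx : w ≠ x) (nwy : w ≠ y) (nwz : w ≠ z) : cartanCoeff (a y) (a w) = 0 := by
    by_contra h
    refine hS.not_golden_fork hT (x := x) (y := y) (z := z) (w := w) ?_ hxy hyz1.le
      (hle nwy.symm h)
    simp [nxy, nxz, nyz, nwx.symm, nwy.symm, nwz.symm]
  have hxw0 := hnx nwx nwy nwz
  have hyw0 := hny nwx nwy nwz
  have hzw : cartanCoeff (a z) (a w) ≠ 0 := by
    rcases hi with rfl | rfl | rfl
    · exact absurd hxw0 hiw
    · exact absurd hyw0 hiw
    · exact hiw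
  have hzw1 : cartanCoeff (a z) (a w) = -1 := by
    rcases hS.cartanCoeff_cases hT (Ne.symm nwz) with h | h | h
    · exact absurd h hzw
    · exact h
    · exact (hS.not_golden_both_ends hT hd4 hxy hyz1.le h).elim
  have hall : ∀ i, i = x ∨ i = y ∨ i = z ∨ i = w := by
    by_contra! hall
    obtain ⟨u₀, hu₀⟩ := hall
    obtain ⟨i, hi, u, hu, hiu⟩ := hS.exists_cartanCoeff_ne_zero hT hind (S := {x, y, z, w})
      ⟨x, by simp⟩ ⟨u₀, by simpa using hu₀⟩
    simp only [Set.mem_insert_iff, Set.mem_singleton_iff, not_or] at hi hu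
    obtain ⟨nux, nuy, nuz, nuw⟩ := hu
    have hd5 : [x, y, z, w, u].Nodup := by
      simp [nxy, nxz, nyz, Ne.symm nwx, Ne.symm nwy, Ne.symm nwz, Ne.symm nux, Ne.symm nuy,
        Ne.symm nuz, Ne.symm nuw]
    rcases hi with rfl | rfl | rfl | rfl
    · exact hiu (hnx nux nuy nuz)
    · exact hiu (hny nux nuy nuz)
    · exact hS.not_golden_path_fork hT hd5 hxy hyz1.le hzw1.le (hle (Ne.symm nuz) hiu)
    · exact hS.not_golden_path_five hT hd5 hxy hyz1.le hzw1.le (hle (Ne.symm nuw) hiu)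
  refine hS.hasCoxeterType_of_bijective hT (g := ![w, z, y, x]) ⟨?_, fun i ↦ ?_⟩ ?_
  · rw [← List.nodup_ofFn]
    simp [Ne.symm nxy, Ne.symm nxz, Ne.symm nyz, nwx, nwy, nwz]
  · rcases hall i with rfl | rfl | rfl | rfl
    exacts [⟨3, rfl⟩, ⟨2, rfl⟩, ⟨1, rfl⟩, ⟨0, rfl⟩]
  · intro i j hij
    fin_cases i <;> fin_cases j <;>
      first
        | exact absurd hij (by decide)
        | simp [CoxeterMatrix.H₄, hcomm w, hcomm z y, hcomm z x, hcomm y x, hxz0, hyz1, hxy, hxw0,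
            hyw0, hzw1]

theorem hasCoxeterType_of_golden_edge {x y : B} (nxy : x ≠ y)
    (hxy : cartanCoeff (a x) (a y) = -φ) :
    rank T = 2 ∧ HasCoxeterType T coxeterMatrixH2 ∨
      rank T = 3 ∧ HasCoxeterType T CoxeterMatrix.H₃ ∨
      rank T = 4 ∧ HasCoxeterType T CoxeterMatrix.H₄ := by
  by_cases hall : ∀ i, i = x ∨ i = y
  · left
    refine hS.hasCoxeterType_of_bijective hT (g := ![x, y]) ⟨?_, fun i ↦ ?_⟩ fun i j hij ↦ ?_
    · rw [← List.nodup_ofFn]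
      simp [nxy]
    · rcases hall i with rfl | rfl
      exacts [⟨0, rfl⟩, ⟨1, rfl⟩]
    · refine Or.inr (Or.inr ⟨coxeterMatrixH2_apply_of_ne hij.ne, ?_⟩)
      obtain ⟨rfl, rfl⟩ : i = 0 ∧ j = 1 := by lia
      exact hxy
  right
  push Not at hall
  obtain ⟨z₀, hz₀⟩ := hall
  obtain ⟨i, hi, z, hz, hiz⟩ := hS.exists_cartanCoeff_ne_zero hT hind (S := {x, y})
    ⟨x, by simp⟩ ⟨z₀, by simpa using hz₀⟩
  simp only [Set.mem_insert_iff, Set.mem_singleton_iff, not_or] at hi hz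
  -- The third vertex may hang on either end of the golden edge; that end becomes the middle of the
  -- path.
  rcases hi with rfl | rfl
  · refine hS.hasCoxeterType_of_golden_path hT hind (x := y) (y := i) (z := z) ?_
      (hS.cartanCoeff_comm hT y i ▸ hxy) hiz
    simp [nxy.symm, Ne.symm hz.1, Ne.symm hz.2]
  · refine hS.hasCoxeterType_of_golden_path hT hind (x := x) (y := i) (z := z) ?_ hxy hiz
    simp [nxy, Ne.symm hz.1, Ne.symm hz.2]

end IsSimpleSystem

end RootShell

theorem theorem6p1 {V : Type*} [NormedAddCommGroup V] [InnerProductSpace ℝ V]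
    [FiniteDimensional ℝ V] (T : Set V)
    (hT : RootShell.IsRootShellSystem RootShell.goldenIntegers T)
    (hind : RootShell.IsIndecomposable T) (hnc : RootShell.IsNonCrystallographic T) :
    RootShell.rank T ∈ ({2, 3, 4} : Set ℕ) ∧
      ((RootShell.rank T = 2 ∧ RootShell.HasCoxeterType T RootShell.coxeterMatrixH2) ∨
        (RootShell.rank T = 3 ∧ RootShell.HasCoxeterType T CoxeterMatrix.H₃) ∨
        (RootShell.rank T = 4 ∧ RootShell.HasCoxeterType T CoxeterMatrix.H₄)) := by
  obtain ⟨Δ, f, hS⟩ := hT.exists_isSimpleSystem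
  obtain ⟨x, y, nxy, hxy⟩ := hS.exists_golden_edge hT hnc
  have h := hS.hasCoxeterType_of_golden_edge hT hind nxy hxy
  refine ⟨?_, h⟩
  rcases h with h | h | h <;> simp [h.1]
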